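/- Fix $0\le q<1$, $0<\sigma\le 1$ and $\mathsf c>0$. Write $(\alpha;q)_n=\prod_{k=0}^{n-1}(1-\alpha q^k)$ and $(\alpha;q)_\infty=\prod_{k=0}^{\infty}(1-\alpha q^k)$, let $a=-q(\sigma+\mathrm i\sqrt{1-\sigma^2})$, $b=-q(\sigma-\mathrm i\sqrt{1-\sigma^2})$, and let $$s_n=\sum_{k=0}^n\frac{(a;q)_k}{(q;q)_k}\,\frac{(b;q)_{n-k}}{(q;q)_{n-k}}\quad(n\ge 0),\qquad s_{-1}=0 .$$ For each integer $N\ge 1$ let $\{X^{(N)}_k\}_{k\ge 0}$ be a Markov chain on $\{0,1,2,\dots\}$ with transition probabilities $$\Pr(X_k=n+1\mid X_{k-1}=n)=\frac{1-q^{n+1}}{1+\sigma}\,\frac{s_{n+1}}{2s_n},\quad \Pr(X_k=n\mid X_{k-1}=n)=\frac{1-q^{n+1}}{1+\sigma}\,\sigma,\quad \Pr(X_k=n-1\mid X_{k-1}=n)=\frac{1-q^{n+1}}{1+\sigma}\,\frac{s_{n-1}}{2s_n},$$ all other transitions having probability $0$, and with initial law $$\Pr(X^{(N)}_0=n)=\frac{1}{C}\,\rho_0^n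 s_n,\qquad C=\frac{(a\rho_0;q)_\infty(b\rho_0;q)_\infty}{(\rho_0;q)_\infty^2},\qquad \rho_0=e^{-\mathsf c/\sqrt N}.$$ Then, as $N\to\infty$, the finite-dimensional distributions of $\bigl\{N^{-1/2}X^{(N)}_{\lfloor Nt\rfloor}\bigr\}_{t\ge 0}$ converge to those of $\{\xi_t\}_{t\ge 0}$, where $\xi$ is the 3-dimensional Bessel process with time scaled by $1/(1+\sigma)$, i.e. the Markov process with transition probabilities $$\Pr(\xi_{s+t}\in dy\mid \xi_s=x)=\frac yx\,\mathsf q_{t/(1+\sigma)}(x,y)\,dy,\quad x,y>0,\ t>0,\ s\ge 0,$$ where $\mathsf q_t(x,y)=\frac{1}{\sqrt{2\pi t}}\bigl(e^{-(y-x)^2/(2t)}-e^{-(y+x)^2/(2t)}\bigr)$ is the transition kernel of Brownian motion killed at hitting zero, and with initial law $\Pr(\xi_0\in dx)=\mathsf c^2xe^{-\mathsf cx}\mathbf 1_{\{x>0\}}\,dx$. Thus for $0=t_0<t_1<\dots<t_d$ the limiting law of $\bigl(N^{-1/2}X^{(N)}_{\lfloor Nt_i\rfloor}\bigr)_{0\le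 i\le d}$ is the probability measure on $(0,\infty)^{d+1}$ with density $\mathsf c^2x_0e^{-\mathsf cx_0}\prod_{i=1}^d\frac{x_i}{x_{i-1}}\mathsf q_{(t_i-t_{i-1})/(1+\sigma)}(x_{i-1},x_i)$. -/

import Mathlib

open MeasureTheory ProbabilityTheory Filter Topology Finset
open scoped NNReal ENNReal

noncomputable section

/-! ### The discrete Markov chain -/

/-- The finite `q`-Pochhammer symbol `(a; q)_n = ∏_{k=0}^{n-1} (1 - a q^k)`. -/
def qPoch (a q : ℂ) (n : ℕ) : ℂ := ∏ k ∈ range n, (1 - a * q ^ k)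

/-- The infinite `q`-Pochhammer symbol `(a; q)_∞ = ∏_{k=0}^∞ (1 - a q^k)`. -/
def qPochInf (a q : ℂ) : ℂ := ∏' k : ℕ, (1 - a * q ^ k)

/-- The parameter `a = -q (σ + i √(1 - σ²))`. -/
def paramA (q σ : ℝ) : ℂ := -q * (σ + Complex.I * (√(1 - σ ^ 2) : ℝ))

/-- The parameter `b = -q (σ - i √(1 - σ²))`. -/
def paramB (q σ : ℝ) : ℂ := -q * (σ - Complex.I * (√(1 - σ ^ 2) : ℝ))

/-- The sum `∑_{k=0}^n (a;q)_k / (q;q)_k * (b;q)_{n-k} / (q;q)_{n-k}`, as a complex number. -/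
def sSeqC (q σ : ℝ) (n : ℕ) : ℂ :=
  ∑ k ∈ range (n + 1), qPoch (paramA q σ) q k / qPoch q q k *
    (qPoch (paramB q σ) q (n - k) / qPoch q q (n - k))

/-- The sequence `s_n`; the sum defining it is real, see `ofReal_sSeq`. -/
def sSeq (q σ : ℝ) (n : ℕ) : ℝ := (sSeqC q σ n).re

/-- The quotient `(aρ;q)_∞ (bρ;q)_∞ / (ρ;q)_∞²`, as a complex number. -/
def normConstC (q σ ρ : ℝ) : ℂ :=
  qPochInf (paramA q σ * ρ) q * qPochInf (paramB q σ * ρ) q / qPochInf ρ q ^ 2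

/-- The normalizing constant `C` of the initial law; it is real, see `ofReal_normConst`. -/
def normConst (q σ ρ : ℝ) : ℝ := (normConstC q σ ρ).re

lemma conj_paramA (q σ : ℝ) : (starRingEnd ℂ) (paramA q σ) = paramB q σ := by
  simp [paramA, paramB, sub_eq_add_neg]

lemma conj_paramB (q σ : ℝ) : (starRingEnd ℂ) (paramB q σ) = paramA q σ := by
  simp [paramA, paramB, sub_eq_add_neg]

lemma conj_qPoch (a : ℂ) (q : ℝ) (n : ℕ) :
    (starRingEnd ℂ) (qPoch a q n) = qPoch ((starRingEnd ℂ) a) q n := by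
  simp [qPoch, map_prod]

lemma ofReal_sSeq (q σ : ℝ) (n : ℕ) : (sSeq q σ n : ℂ) = sSeqC q σ n := by
  refine Complex.conj_eq_iff_re.mp ?_
  unfold sSeqC
  rw [map_sum, ← Finset.sum_range_reflect]
  refine Finset.sum_congr rfl fun k hk => ?_
  have hk' : k ≤ n := by simpa [Nat.lt_succ_iff] using hk
  have h1 : n + 1 - 1 - k = n - k := by omega
  have h2 : n - (n - k) = k := by omega
  simp only [map_mul, map_div₀, conj_qPoch, conj_paramA, conj_paramB, Complex.conj_ofReal, h1, h2]
  ring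

lemma conj_qPochInf (a : ℂ) (q : ℝ) :
    (starRingEnd ℂ) (qPochInf a q) = qPochInf ((starRingEnd ℂ) a) q := by
  unfold qPochInf
  rw [Function.LeftInverse.map_tprod (g := starRingEnd ℂ) (g' := starRingEnd ℂ) _
    Complex.continuous_conj Complex.continuous_conj Complex.conj_conj]
  simp

lemma ofReal_normConst (q σ ρ : ℝ) : (normConst q σ ρ : ℂ) = normConstC q σ ρ := by
  refine Complex.conj_eq_iff_re.mp ?_
  simp only [normConstC, map_mul, map_div₀, map_pow, conj_qPochInf, conj_paramA, conj_paramB,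
    Complex.conj_ofReal]
  ring

/-- The initial law `Pr(X_0 = n) = ρ^n s_n / C`. -/
def chainInit (q σ ρ : ℝ) (n : ℕ) : ℝ := 1 / normConst q σ ρ * (ρ ^ n * sSeq q σ n)

/-- The transition probabilities `Pr(X_k = n | X_{k-1} = m)` on the non-negative integers. -/
def chainTrans (q σ : ℝ) (m n : ℕ) : ℝ :=
  (1 - q ^ (m + 1)) / (1 + σ) *
    (if n = m + 1 then sSeq q σ (m + 1) / (2 * sSeq q σ m)
     else if n = m then σ
     else if n + 1 = m then sSeq q σ (m - 1) / (2 * sSeq q σ m)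
     else 0)

/-- `X` is a Markov chain on the non-negative integers, on the probability space `(Ω, P)`, with
initial law `init` and (time-homogeneous) transition probabilities `p`. -/
structure IsMarkovChain {Ω : Type*} [MeasurableSpace Ω] (P : Measure Ω) (X : ℕ → Ω → ℕ)
    (init : ℕ → ℝ) (p : ℕ → ℕ → ℝ) : Prop where
  measurable : ∀ k, Measurable (X k)
  initial : ∀ n, P.real {ω | X 0 ω = n} = init n
  markov : ∀ (k : ℕ) (x : ℕ → ℕ), P.real {ω | ∀ i ≤ k + 1, X i ω = x i} =
    P.real {ω | ∀ i ≤ k, X i ω = x i} * p (x k) (x (k + 1))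

/-! ### The limit process -/

/-- The transition density at time `t` of the Brownian motion killed at hitting zero. -/
def killedBM (t x y : ℝ) : ℝ :=
  1 / √(2 * Real.pi * t) *
    (Real.exp (-((y - x) ^ 2 / (2 * t))) - Real.exp (-((y + x) ^ 2 / (2 * t))))

/-- The transition density `(y / x) q_{t/(1+σ)}(x, y)`, for `t, x, y > 0`, of the 3-dimensional
Bessel process with time scaled by `1 / (1 + σ)`. -/
def besselDensity (σ t x y : ℝ) : ℝ := y / x * killedBM (t / (1 + σ)) x y

/-- The transition probabilities of that process, started at `x > 0`, at time `t > 0`. -/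
def besselTrans (σ t x : ℝ) : Measure ℝ :=
  (volume.restrict (Set.Ioi 0)).withDensity fun y => ENNReal.ofReal (besselDensity σ t x y)

/-- The initial law, with density `c² x e^{-c x}` on `x > 0`. -/
def besselInit (c : ℝ) : Measure ℝ :=
  (volume.restrict (Set.Ioi 0)).withDensity fun x =>
    ENNReal.ofReal (c ^ 2 * x * Real.exp (-(c * x)))

/-- `ξ` is a (time-homogeneous) real-valued Markov process on the probability space `(Ω, P)`, with
initial law `μ₀` and transition probabilities `κ t x` for `t > 0`: for `s < t`, the conditional law
of `ξ_t` given `(ξ_u)_{u ≤ s}` is `κ (t - s) ξ_s`. -/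
structure IsMarkovProcess {Ω : Type*} [MeasurableSpace Ω] (P : Measure Ω) (ξ : ℝ≥0 → Ω → ℝ)
    (μ₀ : Measure ℝ) (κ : ℝ → ℝ → Measure ℝ) : Prop where
  measurable : ∀ t, Measurable (ξ t)
  initial : P.map (ξ 0) = μ₀
  markov : ∀ s t : ℝ≥0, s < t → ∀ A : Set ℝ, MeasurableSet A →
    P[(ξ t ⁻¹' A).indicator (fun _ => (1 : ℝ)) |
        ⨆ u : Set.Iic s, MeasurableSpace.comap (ξ u) inferInstance]
      =ᵐ[P] fun ω => (κ ((t : ℝ) - s) (ξ s ω)).real A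

/-- The joint law at times `0 = t_0 < t_1 < ⋯ < t_d` of the Markov process with initial law
`besselInit c` and transition probabilities `besselTrans σ`: it lives on `(0, ∞)^{d+1}`, with
density the product of the initial density and of the transition densities. -/
def besselJointLaw (σ c : ℝ) {d : ℕ} (t : Fin (d + 1) → ℝ≥0) : Measure (Fin (d + 1) → ℝ) :=
  (volume.restrict {x | ∀ i, 0 < x i}).withDensity fun x =>
    ENNReal.ofReal (c ^ 2 * x 0 * Real.exp (-(c * x 0)) *
      ∏ i : Fin d, besselDensity σ ((t i.succ : ℝ) - t i.castSucc) (x i.castSucc) (x i.succ))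

end

/-! The generating function F of s_n satisfies (1-z)^2 F(z) = (1-az)(1-bz) F(qz), with a+b = -2qσ
and ab = q^2. The resulting three-term recurrence (`sPrev_rec`) makes the transition probabilities
sum to 1 and makes s convex with summable second differences, of order n q^n, so that s_n ~ K n.
Hence a step from n has second moment tending to 1/(1+σ) and drift asymptotic to 1/((1+σ) n). With
space scaled by h = N^(-1/2), the generator approaches (f''/2 + f'/x)/(1+σ), that of the
time-changed Bessel process.

Convergence is tested on the functions exp(-∑ l_i x_i^2). The Bessel semigroup sends exp(-l x^2) to
(1+2lτ)^(-3/2) exp(-l x^2/(1+2lτ)), so Gaussians stay Gaussian, and so do their products. The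
Laplace functional at several times is thus found by integrating out the last time and adding the
new rate to the weight of the preceding one; `besselLaplace` records this recursion, and both
descriptions of the limit obey it. The chain obeys it approximately: the derivative of a Gaussian
carries a factor x, which absorbs the singular drift 1/x, and one step costs at most a constant
times h^2 (`stepErr` + h) (`abs_stepMean_gaussFlow_sub_le`).

Over O(N) steps this is negligible once the mean of `stepErr` at X_k tends to 0 uniformly in k.
`stepErr` is small only far from the origin, and reversibility keeps the chain there: the weights
w_n = s_n^2/(1-q^(n+1)) are invariant, the initial law is at most w_n/C, this domination persists at
all times (`measureReal_le`), and 1/C tends to 0. The initial law itself is handled by a Riemann sum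
(`tendsto_riemann_sum`).

On the positive orthant the Gaussians span an algebra that separates points, and their integrals
control tails, so convergence of these functionals is weak convergence
(`tendsto_of_tendsto_gaussBCF`). -/

noncomputable section

/-! ### The sequence `s_n` -/

/-- The sequence `0, s_0, s_1, …`, that is, `s_{n-1}` with `s_{-1} = 0`. -/
def sPrev (q σ : ℝ) : ℕ → ℝ
  | 0 => 0
  | n + 1 => sSeq q σ n

lemma sPrev_zero (q σ : ℝ) : sPrev q σ 0 = 0 := rfl

lemma sPrev_succ (q σ : ℝ) (n : ℕ) : sPrev q σ (n + 1) = sSeq q σ n := rfl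

lemma sSeq_zero (q σ : ℝ) : sSeq q σ 0 = 1 := by simp [sSeq, sSeqC, qPoch]

/-- The generating function of `(a; q)_n / (q; q)_n`. -/
def qBinomSeries (a q : ℂ) : PowerSeries ℂ := PowerSeries.mk fun n => qPoch a q n / qPoch q q n

/-- Coefficientwise this is the ratio c_{n+1}/c_n = (1 - a q^n)/(1 - q^{n+1}), cleared of
denominators. -/
lemma qBinomSeries_functional (a q : ℂ) (hq : ∀ n : ℕ, 1 - q * q ^ n ≠ 0) :
    qBinomSeries a q * (1 - PowerSeries.X) =
      PowerSeries.rescale q (qBinomSeries a q) * (1 - PowerSeries.C a * PowerSeries.X) := by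
  have hne : ∀ n, qPoch q q n ≠ 0 := fun n => Finset.prod_ne_zero_iff.mpr fun k _ => hq k
  ext n
  rw [mul_sub, mul_sub, mul_one, mul_one, ← mul_assoc]
  cases n with
  | zero =>
    simp only [map_sub, PowerSeries.coeff_zero_mul_X, PowerSeries.coeff_rescale]
    simp
  | succ n =>
    simp only [map_sub, PowerSeries.coeff_succ_mul_X, PowerSeries.coeff_mul_C,
      PowerSeries.coeff_rescale, qBinomSeries, PowerSeries.coeff_mk]
    have h1 : qPoch a q (n + 1) = qPoch a q n * (1 - a * q ^ n) := prod_range_succ _ _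
    have h2 : qPoch q q (n + 1) = qPoch q q n * (1 - q ^ (n + 1)) := by
      rw [pow_succ']; exact prod_range_succ _ _
    rw [h1, h2]
    have h3 := hne n
    have h4 : 1 - q ^ (n + 1) ≠ 0 := by rw [pow_succ']; exact hq n
    field_simp
    ring

lemma coeff_mul_qBinomSeries (q σ : ℝ) (n : ℕ) :
    PowerSeries.coeff n (qBinomSeries (paramA q σ) q * qBinomSeries (paramB q σ) q) =
      sSeqC q σ n := by
  rw [PowerSeries.coeff_mul, Finset.Nat.sum_antidiagonal_eq_sum_range_succ_mk]
  simp [qBinomSeries, sSeqC]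

lemma paramA_add_paramB (q σ : ℝ) : paramA q σ + paramB q σ = -2 * q * σ := by
  simp only [paramA, paramB]; ring

lemma paramA_mul_paramB (q σ : ℝ) (h0 : 0 ≤ σ) (h1 : σ ≤ 1) :
    paramA q σ * paramB q σ = (q : ℂ) ^ 2 := by
  have h : ((√(1 - σ ^ 2) : ℝ) : ℂ) ^ 2 = 1 - σ ^ 2 := by
    rw [← Complex.ofReal_pow, Real.sq_sqrt (by nlinarith)]; push_cast; ring
  simp only [paramA, paramB]
  linear_combination (-(q : ℂ) ^ 2 * Complex.I ^ 2) * h - q ^ 2 * (1 - σ ^ 2) * Complex.I_sq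

lemma one_sub_pow_succ_pos {q : ℝ} (hq0 : 0 ≤ q) (hq1 : q < 1) (n : ℕ) : 0 < 1 - q ^ (n + 1) := by
  have := pow_lt_one₀ hq0 hq1 (Nat.succ_ne_zero n)
  simpa using this

section
variable {q σ : ℝ} (hq0 : 0 ≤ q) (hq1 : q < 1)
include hq0 hq1

/-- The product of the functional equations for a and b; only a + b and ab enter. -/
lemma sSeq_genFun (h0 : 0 ≤ σ) (h1 : σ ≤ 1) :
    let F := qBinomSeries (paramA q σ) q * qBinomSeries (paramB q σ) q
    F - PowerSeries.C 2 * (F * PowerSeries.X) + F * PowerSeries.X * PowerSeries.X =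
      PowerSeries.rescale (q : ℂ) F
        + PowerSeries.C (2 * q * σ : ℂ) * (PowerSeries.rescale (q : ℂ) F * PowerSeries.X)
        + PowerSeries.C (q ^ 2 : ℂ) *
          (PowerSeries.rescale (q : ℂ) F * PowerSeries.X * PowerSeries.X) := by
  intro F
  have hq : ∀ n : ℕ, (1 : ℂ) - q * q ^ n ≠ 0 := by
    intro n
    have := (one_sub_pow_succ_pos hq0 hq1 n).ne'
    rw [← pow_succ']
    exact_mod_cast this
  have hA := qBinomSeries_functional (paramA q σ) q hq
  have hB := qBinomSeries_functional (paramB q σ) q hq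
  have hs : PowerSeries.C (2 * q * σ : ℂ)
      = -(PowerSeries.C (paramA q σ) + PowerSeries.C (paramB q σ)) := by
    rw [← map_add, paramA_add_paramB, ← map_neg]; congr 1; ring
  have hp : PowerSeries.C ((q : ℂ) ^ 2)
      = PowerSeries.C (paramA q σ) * PowerSeries.C (paramB q σ) := by
    rw [← map_mul, paramA_mul_paramB q σ h0 h1]
  have h2 : (PowerSeries.C 2 : PowerSeries ℂ) = 2 := map_ofNat _ 2
  rw [hs, hp, h2]
  simp only [F, map_mul]
  linear_combination (qBinomSeries (paramB q σ) q * (1 - PowerSeries.X)) * hA +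
    (PowerSeries.rescale (q : ℂ) (qBinomSeries (paramA q σ) q) *
      (1 - PowerSeries.C (paramA q σ) * PowerSeries.X)) * hB

/-- The coefficient of X^(n+1) in `sSeq_genFun`. Everything later used about s_n, beyond s_0 = 1,
comes from this recurrence. -/
lemma sPrev_rec (h0 : 0 ≤ σ) (h1 : σ ≤ 1) (n : ℕ) :
    (1 - q ^ (n + 1)) * (sPrev q σ (n + 2) + sPrev q σ n) =
      2 * (1 + σ * q ^ (n + 1)) * sPrev q σ (n + 1) := by
  have h := sSeq_genFun (σ := σ) hq0 hq1 h0 h1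
  have h' := congrArg (PowerSeries.coeff (n + 1)) h
  have hc : ∀ m, sSeqC q σ m = sPrev q σ (m + 1) := fun m => (ofReal_sSeq q σ m).symm
  simp only [map_add, map_sub, PowerSeries.coeff_C_mul, PowerSeries.coeff_succ_mul_X,
    PowerSeries.coeff_rescale, coeff_mul_qBinomSeries, hc] at h'
  -- For n = 0 the terms carrying X^2 contribute nothing in degree 1, which is the convention s_{-1}
  -- = 0.
  cases n with
  | zero =>
    simp only [PowerSeries.coeff_zero_mul_X, sPrev_zero] at h' ⊢
    simp only [mul_zero, add_zero] at h'
    have h'' : sPrev q σ 2 - 2 * sPrev q σ 1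
        = q ^ 1 * sPrev q σ 2 + 2 * q * σ * (q ^ 0 * sPrev q σ 1) := by exact_mod_cast h'
    linear_combination h''
  | succ n =>
    simp only [PowerSeries.coeff_succ_mul_X, coeff_mul_qBinomSeries, hc,
      PowerSeries.coeff_rescale] at h'
    have h'' : sPrev q σ (n + 3) - 2 * sPrev q σ (n + 2) + sPrev q σ (n + 1)
        = q ^ (n + 2) * sPrev q σ (n + 3) + 2 * q * σ * (q ^ (n + 1) * sPrev q σ (n + 2))
          + q ^ 2 * (q ^ n * sPrev q σ (n + 1)) := by exact_mod_cast h'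
    linear_combination h''

end

/-- The increment `s_n - s_{n-1}`. -/
def sDiff (q σ : ℝ) (n : ℕ) : ℝ := sPrev q σ (n + 1) - sPrev q σ n

lemma sum_sDiff (q σ : ℝ) (n : ℕ) : ∑ i ∈ range n, sDiff q σ i = sPrev q σ n := by
  simp only [sDiff]
  rw [Finset.sum_range_sub]; simp [sPrev_zero]

section
variable {q σ : ℝ} (hq0 : 0 ≤ q) (hq1 : q < 1) (hσ0 : 0 < σ) (hσ1 : σ ≤ 1)
include hq0 hq1 hσ0 hσ1

/-- The recurrence read as a formula for second differences: convexity follows from nonnegativity of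
s. -/
lemma sDiff_succ (n : ℕ) : sDiff q σ (n + 1) =
    sDiff q σ n + 2 * (1 + σ) * (q ^ (n + 1) / (1 - q ^ (n + 1))) * sPrev q σ (n + 1) := by
  have h := sPrev_rec hq0 hq1 hσ0.le hσ1 n
  have hp := (one_sub_pow_succ_pos hq0 hq1 n).ne'
  simp only [sDiff]
  field_simp
  linear_combination h

/-- The two facts feed each other: nonnegative values make the increments grow, and positive
increments keep the values nonnegative. The first increment is s_0 = 1. -/
lemma one_le_sDiff_and_nonneg (n : ℕ) : 1 ≤ sDiff q σ n ∧ 0 ≤ sPrev q σ n := by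
  induction n with
  | zero => simp [sDiff, sPrev, sSeq_zero]
  | succ n ih =>
    have h1 : 0 ≤ sPrev q σ (n + 1) := by
      have : sPrev q σ (n + 1) = sPrev q σ n + sDiff q σ n := by simp [sDiff]
      linarith [ih.1, ih.2]
    refine ⟨?_, h1⟩
    rw [sDiff_succ hq0 hq1 hσ0 hσ1]
    have hp := one_sub_pow_succ_pos hq0 hq1 n
    have : 0 ≤ 2 * (1 + σ) * (q ^ (n + 1) / (1 - q ^ (n + 1))) * sPrev q σ (n + 1) := by positivity
    linarith [ih.1]

lemma sPrev_nonneg (n : ℕ) : 0 ≤ sPrev q σ n := (one_le_sDiff_and_nonneg hq0 hq1 hσ0 hσ1 n).2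

lemma one_le_sDiff (n : ℕ) : 1 ≤ sDiff q σ n := (one_le_sDiff_and_nonneg hq0 hq1 hσ0 hσ1 n).1

lemma sDiff_monotone : Monotone (sDiff q σ) := by
  refine monotone_nat_of_le_succ fun n => ?_
  rw [sDiff_succ hq0 hq1 hσ0 hσ1]
  have hp := one_sub_pow_succ_pos hq0 hq1 n
  have := sPrev_nonneg hq0 hq1 hσ0 hσ1 (n + 1)
  have : 0 ≤ 2 * (1 + σ) * (q ^ (n + 1) / (1 - q ^ (n + 1))) * sPrev q σ (n + 1) := by positivity
  linarith

lemma sPrev_le_mul_sDiff (n : ℕ) : sPrev q σ (n + 1) ≤ (n + 1) * sDiff q σ n := by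
  rw [← sum_sDiff]
  refine (Finset.sum_le_card_nsmul _ _ (sDiff q σ n) fun i hi => ?_).trans (by simp)
  exact sDiff_monotone hq0 hq1 hσ0 hσ1 (by simpa [Nat.lt_succ_iff] using hi)

lemma natCast_le_sPrev (n : ℕ) : (n : ℝ) ≤ sPrev q σ n := by
  rw [← sum_sDiff]
  have := Finset.card_nsmul_le_sum (range n) (sDiff q σ) 1
    fun i _ => one_le_sDiff hq0 hq1 hσ0 hσ1 i
  simpa using this

lemma one_le_sPrev_succ (n : ℕ) : 1 ≤ sPrev q σ (n + 1) := by
  have := natCast_le_sPrev hq0 hq1 hσ0 hσ1 (n + 1)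
  push_cast at this
  linarith [(Nat.cast_nonneg n : (0 : ℝ) ≤ n)]

/-- A discrete Gronwall argument: s_n is at most n+1 times its last increment, so each increment
exceeds the previous one by a factor at most 1 + a_n, with a_n of order n q^n summable. -/
lemma exists_sDiff_le : ∃ B : ℝ, ∀ n, sDiff q σ n ≤ B := by
  set a : ℕ → ℝ := fun n => 2 * (1 + σ) / (1 - q) * ((n + 1 : ℕ) * q ^ (n + 1)) with ha
  have ha0 : ∀ n, 0 ≤ a n := fun n => by
    have : 0 < 1 - q := by linarith
    positivity
  have hsum : Summable a := by
    refine Summable.mul_left _ ?_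
    have h := summable_pow_mul_geometric_of_norm_lt_one (R := ℝ) 1 (r := q)
      (by rwa [Real.norm_of_nonneg hq0])
    simpa using (summable_nat_add_iff 1).mpr h
  have hstep : ∀ n, sDiff q σ (n + 1) ≤ sDiff q σ n * Real.exp (a n) := by
    intro n
    rw [sDiff_succ hq0 hq1 hσ0 hσ1]
    have hp := one_sub_pow_succ_pos hq0 hq1 n
    have hd := one_le_sDiff hq0 hq1 hσ0 hσ1 n
    have hq : 0 < 1 - q := by linarith
    -- This replacement produces the factor 1/(1-q) in `a`.
    have h1 : q ^ (n + 1) / (1 - q ^ (n + 1)) ≤ q ^ (n + 1) / (1 - q) := by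
      have : q ^ (n + 1) ≤ q := pow_le_of_le_one hq0 hq1.le (Nat.succ_ne_zero n)
      gcongr
    have h2 : 2 * (1 + σ) * (q ^ (n + 1) / (1 - q ^ (n + 1))) * sPrev q σ (n + 1)
        ≤ 2 * (1 + σ) * (q ^ (n + 1) / (1 - q)) * ((n + 1) * sDiff q σ n) := by
      gcongr
      · exact sPrev_nonneg hq0 hq1 hσ0 hσ1 _
      · exact sPrev_le_mul_sDiff hq0 hq1 hσ0 hσ1 n
    have h3 : 2 * (1 + σ) * (q ^ (n + 1) / (1 - q)) * ((n + 1) * sDiff q σ n)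
        = sDiff q σ n * a n := by simp only [ha]; push_cast; ring
    have h4 := Real.add_one_le_exp (a n)
    nlinarith
  have hexp : ∀ n, sDiff q σ n ≤ sDiff q σ 0 * Real.exp (∑ i ∈ range n, a i) := by
    intro n
    induction n with
    | zero => simp
    | succ n ih =>
      rw [Finset.sum_range_succ, Real.exp_add, ← mul_assoc]
      exact (hstep n).trans (mul_le_mul_of_nonneg_right ih (Real.exp_pos _).le)
  refine ⟨sDiff q σ 0 * Real.exp (∑' i, a i), fun n => (hexp n).trans ?_⟩
  have := one_le_sDiff hq0 hq1 hσ0 hσ1 0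
  gcongr
  exact hsum.sum_le_tsum _ fun i _ => ha0 i

/-- The increments are monotone and bounded. Since K is their supremum, the linear bound holds for
every n; it provides the domination in `tendsto_riemann_sum`. -/
lemma exists_tendsto_sDiff : ∃ K : ℝ, 0 < K ∧ Tendsto (sDiff q σ) atTop (𝓝 K) ∧
    ∀ n, sPrev q σ n ≤ K * n := by
  obtain ⟨B, hB⟩ := exists_sDiff_le hq0 hq1 hσ0 hσ1
  have hmono := sDiff_monotone hq0 hq1 hσ0 hσ1
  have h : BddAbove (Set.range (sDiff q σ)) := ⟨B, by rintro _ ⟨n, rfl⟩; exact hB n⟩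
  have ht := tendsto_atTop_ciSup hmono h
  refine ⟨_, ?_, ht, fun n => ?_⟩
  · exact lt_of_lt_of_le one_pos ((one_le_sDiff hq0 hq1 hσ0 hσ1 0).trans (le_ciSup h 0))
  · rw [← sum_sDiff]
    refine (Finset.sum_le_card_nsmul _ _ _ fun i _ => le_ciSup h i).trans (le_of_eq ?_)
    simp [mul_comm]

end

lemma tendsto_sPrev_div {q σ K : ℝ} (h : Tendsto (sDiff q σ) atTop (𝓝 K)) :
    Tendsto (fun n : ℕ => sPrev q σ n / n) atTop (𝓝 K) := by
  refine h.cesaro.congr fun n => ?_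
  rw [sum_sDiff]; ring

end

noncomputable section

/-! ### The one-step transition probabilities -/

/-- The probability of a step up from `n`. -/
def upProb (q σ : ℝ) (n : ℕ) : ℝ :=
  (1 - q ^ (n + 1)) / (1 + σ) * (sPrev q σ (n + 2) / (2 * sPrev q σ (n + 1)))

/-- The probability of staying at `n`. -/
def stayProb (q σ : ℝ) (n : ℕ) : ℝ := (1 - q ^ (n + 1)) / (1 + σ) * σ

/-- The probability of a step down from `n`. -/
def downProb (q σ : ℝ) (n : ℕ) : ℝ :=
  (1 - q ^ (n + 1)) / (1 + σ) * (sPrev q σ n / (2 * sPrev q σ (n + 1)))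

/-- The weights of the reversible measure. -/
def revWeight (q σ : ℝ) (n : ℕ) : ℝ := sPrev q σ (n + 1) ^ 2 / (1 - q ^ (n + 1))

lemma chainTrans_eq (q σ : ℝ) (m n : ℕ) : chainTrans q σ m n =
    (if n = m + 1 then upProb q σ m else 0) + (if n = m then stayProb q σ m else 0) +
      (if n + 1 = m then downProb q σ m else 0) := by
  unfold chainTrans upProb stayProb downProb
  rcases eq_or_ne n (m + 1) with rfl | h1
  · simp [sPrev_succ, add_assoc]
  rcases eq_or_ne n m with rfl | h2
  · simp
  rcases eq_or_ne (n + 1) m with rfl | h3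
  · simp [sPrev_succ, add_assoc]
  · simp [h1, h2, h3]

lemma downProb_zero (q σ : ℝ) : downProb q σ 0 = 0 := by simp [downProb, sPrev_zero]

section
variable {q σ : ℝ} (hq0 : 0 ≤ q) (hq1 : q < 1) (hσ0 : 0 < σ) (hσ1 : σ ≤ 1)
include hq0 hq1 hσ0 hσ1

lemma upProb_nonneg (n : ℕ) : 0 ≤ upProb q σ n := by
  have h1 := one_sub_pow_succ_pos hq0 hq1 n
  have h2 := sPrev_nonneg hq0 hq1 hσ0 hσ1 (n + 1)
  have h3 := sPrev_nonneg hq0 hq1 hσ0 hσ1 (n + 2)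
  unfold upProb; positivity

omit hσ1 in
lemma stayProb_nonneg (n : ℕ) : 0 ≤ stayProb q σ n := by
  have h1 := one_sub_pow_succ_pos hq0 hq1 n
  unfold stayProb; positivity

lemma downProb_nonneg (n : ℕ) : 0 ≤ downProb q σ n := by
  have h1 := one_sub_pow_succ_pos hq0 hq1 n
  have h2 := sPrev_nonneg hq0 hq1 hσ0 hσ1 (n + 1)
  have h3 := sPrev_nonneg hq0 hq1 hσ0 hσ1 n
  unfold downProb; positivity

/-- Holds because s_n ≥ 1 and 1 - q^(n+1) ≤ 1. It lets the invariant measure dominate the initial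
law. -/
lemma sSeq_le_revWeight (n : ℕ) : sSeq q σ n ≤ revWeight q σ n := by
  have h1 := one_sub_pow_succ_pos hq0 hq1 n
  have h2 := one_le_sPrev_succ hq0 hq1 hσ0 hσ1 n
  have h3 : 0 ≤ q ^ (n + 1) := by positivity
  rw [← sPrev_succ, revWeight, le_div_iff₀ h1]
  nlinarith

lemma upProb_add_downProb (n : ℕ) :
    upProb q σ n + downProb q σ n = (1 + σ * q ^ (n + 1)) / (1 + σ) := by
  have h := sPrev_rec hq0 hq1 hσ0.le hσ1 n
  have h2 := (lt_of_lt_of_le one_pos (one_le_sPrev_succ hq0 hq1 hσ0 hσ1 n)).ne'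
  have h3 : (1 + σ) ≠ 0 := by positivity
  unfold upProb downProb
  field_simp
  linear_combination h

lemma prob_sum (n : ℕ) : upProb q σ n + stayProb q σ n + downProb q σ n = 1 := by
  have h := upProb_add_downProb hq0 hq1 hσ0 hσ1 n
  have h3 : (1 + σ) ≠ 0 := by positivity
  have : upProb q σ n + stayProb q σ n + downProb q σ n
    = (1 + σ * q ^ (n + 1)) / (1 + σ) + stayProb q σ n := by rw [← h]; ring
  rw [this, stayProb]
  field_simp
  ring

/-- Both sides equal s_n s_{n+1} / (2(1+σ)). -/
lemma detailed_balance (n : ℕ) :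
    revWeight q σ n * upProb q σ n = revWeight q σ (n + 1) * downProb q σ (n + 1) := by
  have h1 := (one_sub_pow_succ_pos hq0 hq1 n).ne'
  have h1' := (one_sub_pow_succ_pos hq0 hq1 (n + 1)).ne'
  have h2 := (lt_of_lt_of_le one_pos (one_le_sPrev_succ hq0 hq1 hσ0 hσ1 n)).ne'
  have h2' := (lt_of_lt_of_le one_pos (one_le_sPrev_succ hq0 hq1 hσ0 hσ1 (n + 1))).ne'
  have h3 : (1 + σ) ≠ 0 := by positivity
  unfold revWeight upProb downProb
  field_simp

lemma tendsto_upProb_add_downProb :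
    Tendsto (fun n => upProb q σ n + downProb q σ n) atTop (𝓝 (1 / (1 + σ))) := by
  simp_rw [upProb_add_downProb hq0 hq1 hσ0 hσ1]
  have h := (tendsto_pow_atTop_nhds_zero_of_lt_one hq0 hq1).comp (tendsto_add_atTop_nat 1)
  simpa using ((h.const_mul σ).const_add 1).div_const (1 + σ)

/-- The difference has numerator s_{n+1} - s_{n-1}, a sum of two consecutive increments tending to
2K, over 2 s_n ~ 2Kn. This is the Bessel drift 1/x. -/
lemma tendsto_mul_upProb_sub_downProb :
    Tendsto (fun n : ℕ => (n : ℝ) * (upProb q σ n - downProb q σ n)) atTop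
      (𝓝 (1 / (1 + σ))) := by
  obtain ⟨K, hK, ht, -⟩ := exists_tendsto_sDiff hq0 hq1 hσ0 hσ1
  have h := (tendsto_pow_atTop_nhds_zero_of_lt_one hq0 hq1).comp (tendsto_add_atTop_nat 1)
  have h2 : Tendsto (fun n : ℕ => sPrev q σ (n + 1) / n) atTop (𝓝 K) := by
    have h3 := (tendsto_sPrev_div ht).comp (tendsto_add_atTop_nat 1)
    have h4 : Tendsto (fun n : ℕ => ((n + 1 : ℕ) : ℝ) / n) atTop (𝓝 1) := by
      have := tendsto_one_div_atTop_nhds_zero_nat (𝕜 := ℝ)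
      have h5 := this.const_add 1
      rw [add_zero] at h5
      refine h5.congr' ?_
      filter_upwards [eventually_gt_atTop 0] with n hn
      have : (n : ℝ) ≠ 0 := by positivity
      push_cast; field_simp
    have h5 := h3.mul h4
    rw [mul_one] at h5
    refine h5.congr fun n => ?_
    have : ((n + 1 : ℕ) : ℝ) ≠ 0 := by positivity
    simp only [Function.comp]
    field_simp
  have h3 : Tendsto (fun n => sDiff q σ (n + 1) + sDiff q σ n) atTop (𝓝 (K + K)) :=
    (ht.comp (tendsto_add_atTop_nat 1)).add ht
  have h4 := ((h.const_sub 1).div_const (1 + σ)).mul (h3.div (h2.const_mul 2) (by positivity))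
  have h5 : (1 - 0) / (1 + σ) * ((K + K) / (2 * K)) = 1 / (1 + σ) := by field_simp; ring
  rw [h5] at h4
  refine h4.congr' ?_
  filter_upwards [eventually_gt_atTop 0] with n hn
  have h6 := (lt_of_lt_of_le one_pos (one_le_sPrev_succ hq0 hq1 hσ0 hσ1 n)).ne'
  have h7 : (n : ℝ) ≠ 0 := by positivity
  have h8 : (1 + σ) ≠ 0 := by positivity
  simp only [Function.comp, upProb, downProb, sDiff, Pi.div_apply]
  field_simp
  ring

/-- The deviation of the drift and the variance of a step from their limits. -/
def stepErr (q σ : ℝ) (n : ℕ) : ℝ :=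
  |n * (upProb q σ n - downProb q σ n) - 1 / (1 + σ)| +
    |upProb q σ n + downProb q σ n - 1 / (1 + σ)|

lemma tendsto_stepErr : Tendsto (stepErr q σ) atTop (𝓝 0) := by
  have h1 := ((tendsto_mul_upProb_sub_downProb hq0 hq1 hσ0 hσ1).sub_const (1 / (1 + σ))).abs
  have h2 := ((tendsto_upProb_add_downProb hq0 hq1 hσ0 hσ1).sub_const (1 / (1 + σ))).abs
  have h3 := h1.add h2
  simp only [sub_self, abs_zero, add_zero] at h3
  exact h3

end

lemma stepErr_nonneg (q σ : ℝ) (n : ℕ) : 0 ≤ stepErr q σ n := by unfold stepErr; positivity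

end

noncomputable section

/-! ### Gaussian test functions -/

/-- The factor `(1 + 2 l τ)^{-3/2}`. -/
def gaussScale (l τ : ℝ) : ℝ := (1 + 2 * l * τ) ^ (-(3 / 2) : ℝ)

/-- The rate `l / (1 + 2 l τ)`. -/
def gaussRate (l τ : ℝ) : ℝ := l / (1 + 2 * l * τ)

/-- The image of `x ↦ exp (-l x²)` under the semigroup of the 3-dimensional Bessel process. -/
def gaussFlow (l τ x : ℝ) : ℝ := gaussScale l τ * Real.exp (-(gaussRate l τ * x ^ 2))

lemma gaussFlow_zero (l x : ℝ) : gaussFlow l 0 x = Real.exp (-(l * x ^ 2)) := by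
  simp [gaussFlow, gaussScale, gaussRate]

lemma mul_exp_neg_le_one (w : ℝ) : w * Real.exp (-w) ≤ 1 := by
  have h := Real.add_one_le_exp w
  rw [Real.exp_neg, ← div_eq_mul_inv, div_le_one (Real.exp_pos _)]
  linarith

lemma sq_mul_exp_neg_le_two {w : ℝ} (hw : 0 ≤ w) : w ^ 2 * Real.exp (-w) ≤ 2 := by
  have h := Real.quadratic_le_exp_of_nonneg hw
  rw [Real.exp_neg, ← div_eq_mul_inv, div_le_iff₀ (Real.exp_pos _)]
  nlinarith

/-- Three applications of the mean value inequality on [-|h|, |h|]. The factor 1/6 is lost, which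
does not matter here. -/
lemma abs_taylor_two_le {g g₁ g₂ g₃ : ℝ → ℝ} (h₁ : ∀ x, HasDerivAt g (g₁ x) x)
    (h₂ : ∀ x, HasDerivAt g₁ (g₂ x) x) (h₃ : ∀ x, HasDerivAt g₂ (g₃ x) x) {M : ℝ}
    (hM : ∀ x, |g₃ x| ≤ M) (x h : ℝ) :
    |g (x + h) - g x - h * g₁ x - h ^ 2 / 2 * g₂ x| ≤ M * |h| ^ 3 := by
  have hM0 : 0 ≤ M := (abs_nonneg _).trans (hM 0)
  have hconv : Convex ℝ (Set.Icc (-|h|) |h|) := convex_Icc _ _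
  have h0 : (0 : ℝ) ∈ Set.Icc (-|h|) |h| := ⟨by simp, abs_nonneg _⟩
  have hh : h ∈ Set.Icc (-|h|) |h| := ⟨neg_abs_le h, le_abs_self h⟩
  have hs : ∀ y : ℝ, HasDerivAt (fun y => x + y) 1 y := fun y => (hasDerivAt_id y).const_add x
  have e2 : ∀ y ∈ Set.Icc (-|h|) |h|, |g₂ (x + y) - g₂ x| ≤ M * |h| := by
    intro y hy
    have := convex_univ.norm_image_sub_le_of_norm_hasDerivWithin_le (f := g₂) (f' := g₃)
      (fun z _ => (h₃ z).hasDerivWithinAt) (fun z _ => hM z) (Set.mem_univ x)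
      (Set.mem_univ (x + y))
    simp only [Real.norm_eq_abs, add_sub_cancel_left] at this
    exact this.trans (mul_le_mul_of_nonneg_left (abs_le.mpr hy) hM0)
  have e1 : ∀ y ∈ Set.Icc (-|h|) |h|, |g₁ (x + y) - g₁ x - y * g₂ x| ≤ M * |h| * |h| := by
    intro y hy
    have := hconv.norm_image_sub_le_of_norm_hasDerivWithin_le
      (f := fun y => g₁ (x + y) - g₁ x - y * g₂ x) (f' := fun y => g₂ (x + y) - g₂ x)
      (fun z _ => by
        have := (((h₂ (x + z)).comp z (hs z)).sub_const (g₁ x)).sub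
          ((hasDerivAt_id z).mul_const (g₂ x))
        exact (this.congr_deriv (by simp)).hasDerivWithinAt) e2 h0 hy
    simp only [Real.norm_eq_abs, add_zero, sub_self, zero_mul, sub_zero] at this
    exact this.trans (mul_le_mul_of_nonneg_left (abs_le.mpr hy) (by positivity))
  have := hconv.norm_image_sub_le_of_norm_hasDerivWithin_le
    (f := fun y => g (x + y) - g x - y * g₁ x - y ^ 2 / 2 * g₂ x)
    (f' := fun y => g₁ (x + y) - g₁ x - y * g₂ x)
    (fun z _ => by
      have := ((((h₁ (x + z)).comp z (hs z)).sub_const (g x)).sub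
        ((hasDerivAt_id z).mul_const (g₁ x))).sub
        ((((hasDerivAt_id z).pow 2).div_const 2).mul_const (g₂ x))
      refine (this.congr_deriv ?_).hasDerivWithinAt
      simp) e1 h0 hh
  simp only [Real.norm_eq_abs, add_zero, sub_self, zero_mul, sub_zero] at this
  refine (le_of_eq ?_).trans (this.trans (le_of_eq (by ring)))
  congr 1; ring

/-- One-sided, because the time derivatives of the Gaussian flow are controlled only for nonnegative
times. -/
lemma abs_taylor_one_le {g g₁ g₂ : ℝ → ℝ} {M τ h : ℝ} (hh : 0 ≤ h)
    (h₁ : ∀ x, τ ≤ x → HasDerivAt g (g₁ x) x)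
    (h₂ : ∀ x, τ ≤ x → HasDerivAt g₁ (g₂ x) x) (hM : ∀ x, τ ≤ x → |g₂ x| ≤ M) :
    |g (τ + h) - g τ - h * g₁ τ| ≤ M * h ^ 2 := by
  have hM0 : 0 ≤ M := (abs_nonneg _).trans (hM τ le_rfl)
  have hconv : Convex ℝ (Set.Icc τ (τ + h)) := convex_Icc _ _
  have h0 : τ ∈ Set.Icc τ (τ + h) := ⟨le_rfl, by linarith⟩
  have h1 : τ + h ∈ Set.Icc τ (τ + h) := ⟨by linarith, le_rfl⟩
  have e1 : ∀ y ∈ Set.Icc τ (τ + h), |g₁ y - g₁ τ| ≤ M * h := by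
    intro y hy
    have := hconv.norm_image_sub_le_of_norm_hasDerivWithin_le (f := g₁) (f' := g₂)
      (fun z hz => (h₂ z hz.1).hasDerivWithinAt) (fun z hz => hM z hz.1) h0 hy
    simp only [Real.norm_eq_abs] at this
    refine this.trans (mul_le_mul_of_nonneg_left ?_ hM0)
    rw [abs_of_nonneg (by linarith [hy.1])]
    linarith [hy.2]
  have := hconv.norm_image_sub_le_of_norm_hasDerivWithin_le
    (f := fun y => g y - y * g₁ τ) (f' := fun y => g₁ y - g₁ τ)
    (fun z hz => by
      have := (h₁ z hz.1).sub ((hasDerivAt_id z).mul_const (g₁ τ))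
      exact (this.congr_deriv (by simp)).hasDerivWithinAt) e1 h0 h1
  simp only [Real.norm_eq_abs, add_sub_cancel_left, abs_of_nonneg hh] at this
  refine (le_of_eq ?_).trans (this.trans (le_of_eq (by ring)))
  congr 1; ring

/-- The bound is uniform over rates m ≤ l because the flow only lowers the rate, so one constant
serves all times. -/
lemma abs_gaussian_taylor_le {m l : ℝ} (hm : 0 ≤ m) (hml : m ≤ l) (x h : ℝ) :
    |Real.exp (-(m * (x + h) ^ 2)) - Real.exp (-(m * x ^ 2))
      - h * (-(2 * m * x) * Real.exp (-(m * x ^ 2)))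
      - h ^ 2 / 2 * ((4 * m ^ 2 * x ^ 2 - 2 * m) * Real.exp (-(m * x ^ 2)))| ≤
      (10 * l ^ 2 + 14 * l) * |h| ^ 3 := by
  have hexp : ∀ x, HasDerivAt (fun x => Real.exp (-(m * x ^ 2)))
      (-(2 * m * x) * Real.exp (-(m * x ^ 2))) x := fun x => by
    have := (((hasDerivAt_id x).pow 2).const_mul m).neg.exp
    refine this.congr_deriv ?_
    simp; ring
  refine abs_taylor_two_le (g := fun x => Real.exp (-(m * x ^ 2)))
    (g₁ := fun x => -(2 * m * x) * Real.exp (-(m * x ^ 2)))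
    (g₂ := fun x => (4 * m ^ 2 * x ^ 2 - 2 * m) * Real.exp (-(m * x ^ 2)))
    (g₃ := fun x => (12 * m ^ 2 * x - 8 * m ^ 3 * x ^ 3) * Real.exp (-(m * x ^ 2)))
    hexp (fun x => ?_) (fun x => ?_) (fun x => ?_) x h
  · have := ((hasDerivAt_id x).const_mul (2 * m)).neg.mul (hexp x)
    refine this.congr_deriv ?_
    simp; ring
  · have := ((((hasDerivAt_id x).pow 2).const_mul (4 * m ^ 2)).sub_const (2 * m)).mul (hexp x)
    refine this.congr_deriv ?_
    simp; ring
  · set w := m * x ^ 2 with hw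
    have hw0 : 0 ≤ w := by positivity
    set E := Real.exp (-w)
    have hE0 : 0 < E := Real.exp_pos _
    have hE1 : E ≤ 1 := Real.exp_le_one_iff.mpr (by linarith)
    have hE2 : w * E ≤ 1 := mul_exp_neg_le_one w
    have hE3 : w ^ 2 * E ≤ 2 := sq_mul_exp_neg_le_two hw0
    -- From m(|x|-1)^2 ≥ 0. It turns the odd powers of x in the third derivative into a polynomial
    -- in w, which the exponential then absorbs.
    have hx : m * |x| ≤ (m + w) / 2 := by
      have : 0 ≤ m * (|x| - 1) ^ 2 := by positivity
      have h2 : |x| ^ 2 = x ^ 2 := sq_abs x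
      nlinarith
    have h3 : |12 * m ^ 2 * x - 8 * m ^ 3 * x ^ 3| ≤
        12 * m * (m * |x|) + 8 * (m * |x|) * (m * w) := by
      refine (abs_sub _ _).trans (le_of_eq ?_)
      rw [abs_mul, abs_mul (8 * m ^ 3), abs_pow, hw, ← sq_abs x,
        abs_of_nonneg (by positivity : 0 ≤ 12 * m ^ 2),
        abs_of_nonneg (by positivity : 0 ≤ 8 * m ^ 3)]
      ring
    rw [abs_mul, abs_of_pos hE0]
    have h4 : 12 * m * (m * |x|) + 8 * (m * |x|) * (m * w) ≤
        12 * m * ((m + w) / 2) + 8 * ((m + w) / 2) * (m * w) := by gcongr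
    calc |12 * m ^ 2 * x - 8 * m ^ 3 * x ^ 3| * E
        ≤ (12 * m * ((m + w) / 2) + 8 * ((m + w) / 2) * (m * w)) * E := by
          gcongr; exact h3.trans h4
      _ = 6 * m ^ 2 * E + (6 * m + 4 * m ^ 2) * (w * E) + 4 * m * (w ^ 2 * E) := by ring
      _ ≤ 6 * m ^ 2 * 1 + (6 * m + 4 * m ^ 2) * 1 + 4 * m * 2 := by gcongr
      _ ≤ 10 * l ^ 2 + 14 * l := by nlinarith

section
variable {l τ : ℝ} (hl : 0 ≤ l) (hτ : 0 ≤ τ)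
include hl hτ

lemma one_le_one_add_mul : 1 ≤ 1 + 2 * l * τ := by
  have : 0 ≤ 2 * l * τ := by positivity
  linarith

lemma gaussScale_pos : 0 < gaussScale l τ :=
  Real.rpow_pos_of_pos (by linarith [one_le_one_add_mul hl hτ]) _

lemma gaussScale_le_one : gaussScale l τ ≤ 1 :=
  Real.rpow_le_one_of_one_le_of_nonpos (one_le_one_add_mul hl hτ) (by norm_num)

lemma gaussRate_nonneg : 0 ≤ gaussRate l τ :=
  div_nonneg hl (by linarith [one_le_one_add_mul hl hτ])

lemma gaussRate_le : gaussRate l τ ≤ l := div_le_self hl (one_le_one_add_mul hl hτ)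

lemma hasDerivAt_gaussScale :
    HasDerivAt (gaussScale l) (-3 * gaussRate l τ * gaussScale l τ) τ := by
  have h1 := one_le_one_add_mul hl hτ
  have h0 : 1 + 2 * l * τ ≠ 0 := by positivity
  have := (((hasDerivAt_id τ).const_mul (2 * l)).const_add 1).rpow_const (p := -(3 / 2))
    (Or.inl (by simpa using h0))
  refine this.congr_deriv ?_
  simp only [id, Real.rpow_sub_one h0, gaussScale, gaussRate]
  field_simp

lemma hasDerivAt_gaussRate : HasDerivAt (gaussRate l) (-2 * gaussRate l τ ^ 2) τ := by
  have h1 := one_le_one_add_mul hl hτ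
  have h0 : 1 + 2 * l * τ ≠ 0 := by positivity
  have := (hasDerivAt_const τ l).div (((hasDerivAt_id τ).const_mul (2 * l)).const_add 1)
    (by simpa using h0)
  refine this.congr_deriv ?_
  simp only [id, gaussRate]
  field_simp
  ring

/-- For x ≠ 0 the derivative equals g''/2 + g'/x for g the flow at time τ: this is the backward
equation of the Bessel process. -/
lemma hasDerivAt_gaussFlow (x : ℝ) : HasDerivAt (fun τ => gaussFlow l τ x)
    ((2 * gaussRate l τ ^ 2 * x ^ 2 - 3 * gaussRate l τ) * gaussFlow l τ x) τ := by
  have := (hasDerivAt_gaussScale hl hτ).mul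
    (((hasDerivAt_gaussRate hl hτ).mul_const (x ^ 2)).neg.exp)
  refine this.congr_deriv ?_
  simp only [gaussFlow, Pi.neg_apply]
  ring

lemma hasDerivAt_gaussFlow_deriv (x : ℝ) :
    HasDerivAt
      (fun τ => (2 * gaussRate l τ ^ 2 * x ^ 2 - 3 * gaussRate l τ) * gaussFlow l τ x)
      (((2 * gaussRate l τ ^ 2 * x ^ 2 - 3 * gaussRate l τ) ^ 2 + 6 * gaussRate l τ ^ 2
        - 8 * gaussRate l τ ^ 3 * x ^ 2) * gaussFlow l τ x) τ := by
  have h := hasDerivAt_gaussRate hl hτ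
  have := ((((h.pow 2).const_mul 2).mul_const (x ^ 2)).sub (h.const_mul 3)).mul
    (hasDerivAt_gaussFlow hl hτ x)
  refine this.congr_deriv ?_
  simp
  ring

lemma abs_gaussFlow_deriv_le (x : ℝ) :
    |(2 * gaussRate l τ ^ 2 * x ^ 2 - 3 * gaussRate l τ) * gaussFlow l τ x| ≤ 5 * l := by
  have hm := gaussRate_nonneg hl hτ
  have hml := gaussRate_le hl hτ
  have ha := gaussScale_pos hl hτ
  have ha1 := gaussScale_le_one hl hτ
  simp only [gaussFlow]
  set m := gaussRate l τ
  set w := m * x ^ 2 with hw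
  have hw0 : 0 ≤ w := by positivity
  have hE0 : 0 < Real.exp (-w) := Real.exp_pos _
  have hE1 : Real.exp (-w) ≤ 1 := Real.exp_le_one_iff.mpr (by linarith)
  have hE2 := mul_exp_neg_le_one w
  rw [abs_mul, abs_of_pos (mul_pos ha hE0)]
  have h3 : |2 * m ^ 2 * x ^ 2 - 3 * m| ≤ m * (2 * w + 3) := by
    rw [abs_le]; constructor <;> rw [hw] <;> nlinarith [mul_nonneg hm hw0]
  calc |2 * m ^ 2 * x ^ 2 - 3 * m| * (gaussScale l τ * Real.exp (-w))
      ≤ (m * (2 * w + 3)) * (1 * Real.exp (-w)) := by gcongr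
    _ = m * (2 * (w * Real.exp (-w)) + 3 * Real.exp (-w)) := by ring
    _ ≤ m * (2 * 1 + 3 * 1) := by gcongr
    _ ≤ 5 * l := by linarith

/-- With w = m x^2 the prefactor is m^2 (4w^2 - 20w + 15); the bounds w^2 e^(-w) ≤ 2 and w e^(-w) ≤
1 give 43 = 8 + 20 + 15. -/
lemma abs_gaussFlow_deriv₂_le (x : ℝ) :
    |((2 * gaussRate l τ ^ 2 * x ^ 2 - 3 * gaussRate l τ) ^ 2 + 6 * gaussRate l τ ^ 2
        - 8 * gaussRate l τ ^ 3 * x ^ 2) * gaussFlow l τ x| ≤ 43 * l ^ 2 := by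
  have hm := gaussRate_nonneg hl hτ
  have hml := gaussRate_le hl hτ
  have ha := gaussScale_pos hl hτ
  have ha1 := gaussScale_le_one hl hτ
  simp only [gaussFlow]
  set m := gaussRate l τ
  set w := m * x ^ 2 with hw
  have hw0 : 0 ≤ w := by positivity
  have hE0 : 0 < Real.exp (-w) := Real.exp_pos _
  have hE1 : Real.exp (-w) ≤ 1 := Real.exp_le_one_iff.mpr (by linarith)
  have hE2 := mul_exp_neg_le_one w
  have hE3 := sq_mul_exp_neg_le_two hw0
  rw [abs_mul, abs_of_pos (mul_pos ha hE0)]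
  have h3 : |(2 * m ^ 2 * x ^ 2 - 3 * m) ^ 2 + 6 * m ^ 2 - 8 * m ^ 3 * x ^ 2| ≤
      m ^ 2 * (4 * w ^ 2 + 20 * w + 15) := by
    have : (2 * m ^ 2 * x ^ 2 - 3 * m) ^ 2 + 6 * m ^ 2 - 8 * m ^ 3 * x ^ 2
      = m ^ 2 * (4 * w ^ 2 - 20 * w + 15) := by rw [hw]; ring
    rw [this, abs_mul, abs_of_nonneg (by positivity : 0 ≤ m ^ 2)]
    gcongr
    rw [abs_le]; constructor <;> nlinarith [sq_nonneg w]
  calc _ ≤ (m ^ 2 * (4 * w ^ 2 + 20 * w + 15)) * (1 * Real.exp (-w)) := by gcongr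
    _ = m ^ 2 * (4 * (w ^ 2 * Real.exp (-w)) + 20 * (w * Real.exp (-w)) + 15 * Real.exp (-w)) := by
      ring
    _ ≤ m ^ 2 * (4 * 2 + 20 * 1 + 15 * 1) := by gcongr
    _ ≤ 43 * l ^ 2 := by nlinarith

lemma gaussFlow_pos (x : ℝ) : 0 < gaussFlow l τ x :=
  mul_pos (gaussScale_pos hl hτ) (Real.exp_pos _)

lemma gaussFlow_le_one (x : ℝ) : gaussFlow l τ x ≤ 1 := by
  have h1 := gaussScale_le_one hl hτ
  have h2 := gaussRate_nonneg hl hτ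
  have h3 : Real.exp (-(gaussRate l τ * x ^ 2)) ≤ 1 :=
    Real.exp_le_one_iff.mpr (by have := mul_nonneg h2 (sq_nonneg x); linarith)
  exact mul_le_one₀ h1 (Real.exp_pos _).le h3

end

lemma abs_gaussFlow_sub_le {l τ τ' : ℝ} (hl : 0 ≤ l) (hτ : 0 ≤ τ) (hτ' : 0 ≤ τ') (x : ℝ) :
    |gaussFlow l τ x - gaussFlow l τ' x| ≤ 5 * l * |τ - τ'| :=
  (convex_Ici (0 : ℝ)).norm_image_sub_le_of_norm_hasDerivWithin_le
    (fun _ hz => (hasDerivAt_gaussFlow hl hz x).hasDerivWithinAt)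
    (fun _ hz => abs_gaussFlow_deriv_le hl hz x) hτ' hτ

/-- The constant in the one-step error bound. -/
def stepConst (l : ℝ) : ℝ := 53 * l ^ 2 + 17 * l

/-- The expectation of `f` after one step from `n`. -/
def stepMean (q σ : ℝ) (f : ℕ → ℝ) (n : ℕ) : ℝ :=
  upProb q σ n * f (n + 1) + stayProb q σ n * f n + downProb q σ n * f (n - 1)

/-- Consistency of one chain step with flow time h^2/(1+σ). In the spatial expansion the first-order
term h(u-d)g' becomes h^2 n(u-d)(-2m)g, since g' = -2mxg and x = nh; so the drift enters only
through n(u-d), even near the origin. -/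
lemma abs_stepMean_gaussFlow_sub_le {q σ l τ h : ℝ} (hq0 : 0 ≤ q) (hq1 : q < 1) (hσ0 : 0 < σ)
    (hσ1 : σ ≤ 1) (hl : 0 ≤ l) (hτ : 0 ≤ τ) (h0 : 0 ≤ h) (h1 : h ≤ 1) (n : ℕ) :
    |stepMean q σ (fun k => gaussFlow l τ (k * h)) n
      - gaussFlow l (τ + h ^ 2 / (1 + σ)) (n * h)| ≤
      stepConst l * h ^ 2 * (stepErr q σ n + h) := by
  have hm := gaussRate_nonneg hl hτ
  have hml := gaussRate_le hl hτ
  have ha := gaussScale_pos hl hτ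
  have ha1 := gaussScale_le_one hl hτ
  have hu := upProb_nonneg hq0 hq1 hσ0 hσ1 n
  have hd := downProb_nonneg hq0 hq1 hσ0 hσ1 n
  have hs := stayProb_nonneg hq0 hq1 hσ0 n
  have hsum := prob_sum hq0 hq1 hσ0 hσ1 n
  have htime := abs_taylor_one_le (g := fun τ => gaussFlow l τ (n * h)) (τ := τ)
    (h := h ^ 2 / (1 + σ)) (by positivity)
    (fun z hz => hasDerivAt_gaussFlow hl (hτ.trans hz) (n * h))
    (fun z hz => hasDerivAt_gaussFlow_deriv hl (hτ.trans hz) (n * h))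
    (fun z hz => abs_gaussFlow_deriv₂_le hl (hτ.trans hz) (n * h))
  have hup := abs_gaussian_taylor_le hm hml (n * h) h
  have hdown := abs_gaussian_taylor_le hm hml (n * h) (-h)
  -- The time remainder has order h^4; h ≤ 1 brings it to the order h^3 of the spatial one.
  have htime' : 43 * l ^ 2 * (h ^ 2 / (1 + σ)) ^ 2 ≤ 43 * l ^ 2 * h ^ 3 := by
    have e1 : h ^ 2 / (1 + σ) ≤ h ^ 2 := div_le_self (by positivity) (by linarith)
    have e2 : (h ^ 2) ^ 2 ≤ h ^ 3 := by nlinarith [pow_nonneg h0 3]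
    gcongr
    exact (pow_le_pow_left₀ (by positivity) e1 2).trans e2
  -- At n = 0 truncated subtraction gives 0 in place of -1, but the weight of a step down vanishes
  -- there.
  have hdn : downProb q σ n * gaussFlow l τ ((n - 1 : ℕ) * h)
      = downProb q σ n * gaussFlow l τ (n * h + -h) := by
    rcases n with _ | n
    · simp [downProb_zero]
    · congr 2; push_cast [Nat.add_sub_cancel]; ring
  rw [abs_neg, abs_of_nonneg h0] at hdown
  rw [abs_of_nonneg h0] at hup
  set m := gaussRate l τ
  set x : ℝ := n * h with hx
  set E := Real.exp (-(m * x ^ 2)) with hE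
  set w := m * x ^ 2 with hw
  have hw0 : 0 ≤ w := by positivity
  have hE0 : 0 < E := Real.exp_pos _
  have hE1 : E ≤ 1 := Real.exp_le_one_iff.mpr (by linarith)
  have hE2 : w * E ≤ 1 := mul_exp_neg_le_one w
  set A := gaussScale l τ
  set Ru := Real.exp (-(m * (x + h) ^ 2)) - E - h * (-(2 * m * x) * E)
    - h ^ 2 / 2 * ((4 * m ^ 2 * x ^ 2 - 2 * m) * E)
  set Rd := Real.exp (-(m * (x + -h) ^ 2)) - E - -h * (-(2 * m * x) * E)
    - (-h) ^ 2 / 2 * ((4 * m ^ 2 * x ^ 2 - 2 * m) * E)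
  set Rt := gaussFlow l (τ + h ^ 2 / (1 + σ)) x - gaussFlow l τ x
    - h ^ 2 / (1 + σ) * ((2 * m ^ 2 * x ^ 2 - 3 * m) * gaussFlow l τ x) with hRt
  set u := upProb q σ n
  set d := downProb q σ n
  set s := stayProb q σ n
  have hs' : s = 1 - u - d := by linarith
  set e₁ := n * (u - d) - 1 / (1 + σ) with he1
  set e₂ := u + d - 1 / (1 + σ) with he2
  have hstep : stepMean q σ (fun k => gaussFlow l τ (k * h)) n
      = u * gaussFlow l τ (x + h) + s * gaussFlow l τ x + d * gaussFlow l τ (x + -h) := by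
    simp only [stepMean]
    rw [hdn]
    have : ((n + 1 : ℕ) : ℝ) * h = x + h := by push_cast; ring
    rw [this]
  have hflow : ∀ y, gaussFlow l τ y = A * Real.exp (-(m * y ^ 2)) := fun y => rfl
  -- The parts with coefficient 1/(1+σ) cancel against the time derivative by the backward equation;
  -- what is left are the Taylor remainders and the deviations e₁, e₂.
  have hkey : stepMean q σ (fun k => gaussFlow l τ (k * h)) n
      - gaussFlow l (τ + h ^ 2 / (1 + σ)) x
      = A * (u * Ru + d * Rd) - Rt
        + h ^ 2 * A * (e₁ * (-(2 * m) * E) + e₂ * ((2 * m * w - m) * E)) := by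
    rw [hstep, hRt]
    simp only [hflow, Ru, Rd, he1, he2, hs', hw, hx]
    ring
  rw [hkey]
  have b1 : |A * (u * Ru + d * Rd)| ≤ (10 * l ^ 2 + 14 * l) * h ^ 3 := by
    rw [abs_mul, abs_of_pos ha]
    have : |u * Ru + d * Rd| ≤ u * ((10 * l ^ 2 + 14 * l) * h ^ 3)
        + d * ((10 * l ^ 2 + 14 * l) * h ^ 3) := by
      refine (abs_add_le _ _).trans ?_
      rw [abs_mul, abs_mul, abs_of_nonneg hu, abs_of_nonneg hd]
      gcongr
    have h4 : 0 ≤ (10 * l ^ 2 + 14 * l) * h ^ 3 := by positivity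
    calc A * |u * Ru + d * Rd| ≤ 1 * |u * Ru + d * Rd| := by gcongr
      _ ≤ (u + d) * ((10 * l ^ 2 + 14 * l) * h ^ 3) := by linarith
      _ ≤ 1 * ((10 * l ^ 2 + 14 * l) * h ^ 3) := by gcongr; linarith
      _ = _ := one_mul _
  have b2 : |Rt| ≤ 43 * l ^ 2 * h ^ 3 := htime.trans htime'
  have b3 : |h ^ 2 * A * (e₁ * (-(2 * m) * E) + e₂ * ((2 * m * w - m) * E))| ≤
      h ^ 2 * (3 * l * (|e₁| + |e₂|)) := by
    rw [abs_mul, abs_of_nonneg (by positivity : 0 ≤ h ^ 2 * A)]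
    have c1 : |-(2 * m) * E| ≤ 3 * l := by
      rw [neg_mul, abs_neg, abs_of_nonneg (by positivity)]
      have : 2 * m * E ≤ 2 * m * 1 := by gcongr
      linarith
    have c2 : |(2 * m * w - m) * E| ≤ 3 * l := by
      have : (2 * m * w - m) * E = 2 * m * (w * E) - m * E := by ring
      rw [this]
      have d1 : 0 ≤ w * E := by positivity
      have d2 : 2 * m * (w * E) ≤ 2 * m * 1 := by gcongr
      have d3 : m * E ≤ m * 1 := by gcongr
      have d4 : 0 ≤ 2 * m * (w * E) := by positivity
      have d5 : 0 ≤ m * E := by positivity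
      rw [abs_le]; constructor <;> linarith
    have c3 : |e₁ * (-(2 * m) * E) + e₂ * ((2 * m * w - m) * E)| ≤ 3 * l * (|e₁| + |e₂|) := by
      refine (abs_add_le _ _).trans ?_
      rw [abs_mul e₁, abs_mul e₂]
      have := mul_le_mul_of_nonneg_left c1 (abs_nonneg e₁)
      have := mul_le_mul_of_nonneg_left c2 (abs_nonneg e₂)
      linarith
    have : h ^ 2 * A ≤ h ^ 2 := mul_le_of_le_one_right (by positivity) ha1
    exact mul_le_mul this c3 (abs_nonneg _) (by positivity)
  have hse : stepErr q σ n = |e₁| + |e₂| := rfl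
  rw [hse]
  refine (abs_add_le _ _).trans ((add_le_add_left (abs_sub _ _) _).trans ?_)
  -- The slack left when b1, b2, b3 are bounded with the common constant: 53 = 10 + 43 and 17 = 14 +
  -- 3.
  have h6 : 0 ≤ (53 * l ^ 2 + 14 * l) * (h ^ 2 * (|e₁| + |e₂|)) + 3 * l * h ^ 3 := by positivity
  simp only [stepConst]
  linarith

end

noncomputable section

/-! ### One step of the chain -/

/-- `Z` depends on the chain only up to time `k`. -/
def DependsUpTo {Ω β : Type*} (X : ℕ → Ω → ℕ) (k : ℕ) (Z : Ω → β) : Prop :=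
  ∀ ω ω', (∀ i ≤ k, X i ω = X i ω') → Z ω = Z ω'

lemma DependsUpTo.mono {Ω β : Type*} {X : ℕ → Ω → ℕ} {k m : ℕ} {Z : Ω → β}
    (h : DependsUpTo X k Z) (hkm : k ≤ m) : DependsUpTo X m Z :=
  fun ω ω' hω => h ω ω' fun i hi => hω i (hi.trans hkm)

/-- A function of the path up to k lives on a countable space: it is automatically measurable, and
its integrals are sums. -/
lemma DependsUpTo.exists_eq {Ω β : Type*} [Nonempty β] {X : ℕ → Ω → ℕ} {k : ℕ} {Z : Ω → β}
    (h : DependsUpTo X k Z) : ∃ G : (Fin (k + 1) → ℕ) → β, ∀ ω, Z ω = G fun i => X i ω := by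
  refine ⟨Function.extend (fun ω (i : Fin (k + 1)) => X i ω) Z
    fun _ => Classical.arbitrary β, fun ω => ?_⟩
  have hf : Function.FactorsThrough Z (fun ω (i : Fin (k + 1)) => X i ω) := fun ω ω' hω =>
    h ω ω' fun i hi => congrFun hω ⟨i, Nat.lt_succ_of_le hi⟩
  exact (hf.extend_apply _ ω).symm

section
variable {Ω : Type*} [MeasurableSpace Ω] {P : Measure Ω} {X : ℕ → Ω → ℕ} {init : ℕ → ℝ}

lemma IsMarkovChain.measurable_path {p : ℕ → ℕ → ℝ} (hX : IsMarkovChain P X init p) (k : ℕ) :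
    Measurable fun ω (i : Fin (k + 1)) => X i ω :=
  measurable_pi_lambda _ fun i => hX.measurable i

lemma IsMarkovChain.measurable_of_dependsUpTo {β : Type*} [Nonempty β] [MeasurableSpace β]
    {p : ℕ → ℕ → ℝ} (hX : IsMarkovChain P X init p) {k : ℕ} {Z : Ω → β}
    (hZ : DependsUpTo X k Z) : Measurable Z := by
  obtain ⟨G, hG⟩ := hZ.exists_eq
  have : Z = G ∘ fun ω (i : Fin (k + 1)) => X i ω := funext hG
  rw [this]
  exact (measurable_of_countable G).comp (hX.measurable_path k)

/-- Both sides are sums over pairs (path up to k, next state), and the Markov property compares them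
atom by atom, so no conditional expectation is needed. -/
lemma IsMarkovChain.lintegral_step [IsProbabilityMeasure P] {p : ℕ → ℕ → ℝ}
    (hX : IsMarkovChain P X init p) {k : ℕ} {Z : Ω → ℝ≥0∞} (hZ : DependsUpTo X k Z)
    (f : ℕ → ℝ≥0∞) :
    ∫⁻ ω, Z ω * f (X (k + 1) ω) ∂P =
      ∫⁻ ω, Z ω * ∑' n, ENNReal.ofReal (p (X k ω) n) * f n ∂P := by
  obtain ⟨G, hG⟩ := hZ.exists_eq
  have hY := hX.measurable_path k
  set Y : Ω → Fin (k + 1) → ℕ := fun ω i => X i ω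
  have hYX : Measurable fun ω => (Y ω, X (k + 1) ω) := hY.prodMk (hX.measurable (k + 1))
  have hmarkov : ∀ (y : Fin (k + 1) → ℕ) (n : ℕ),
      P {ω | (Y ω, X (k + 1) ω) = (y, n)} =
        P {ω | Y ω = y} * ENNReal.ofReal (p (y (Fin.last k)) n) := by
    intro y n
    -- The path y prolonged by the constant n; only its value at time k+1 matters.
    set x : ℕ → ℕ := fun i => if h : i < k + 1 then y ⟨i, h⟩ else n with hx
    have e1 : {ω | ∀ i ≤ k, X i ω = x i} = {ω | Y ω = y} := by
      ext ω
      simp only [Set.mem_ofPred_eq, funext_iff, Fin.forall_iff, Y]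
      refine forall_congr' fun i => ⟨fun h hi => ?_, fun h hi => ?_⟩
      · rw [h (Nat.lt_succ_iff.mp hi)]; exact dif_pos hi
      · rw [h (Nat.lt_succ_of_le hi)]; simp only [hx]; rw [dif_pos (Nat.lt_succ_of_le hi)]
    have e2 : {ω | ∀ i ≤ k + 1, X i ω = x i} = {ω | (Y ω, X (k + 1) ω) = (y, n)} := by
      ext ω
      have h1 : (∀ i ≤ k + 1, X i ω = x i) ↔ (∀ i ≤ k, X i ω = x i) ∧ X (k + 1) ω = x (k + 1) := by
        refine ⟨fun h => ⟨fun i hi => h i (hi.trans (Nat.le_succ k)), h _ le_rfl⟩, fun h i hi => ?_⟩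
        rcases Nat.le_succ_iff.mp hi with hi | rfl
        exacts [h.1 i hi, h.2]
      have h2 : x (k + 1) = n := by simp [hx]
      have h3 : (∀ i ≤ k, X i ω = x i) ↔ Y ω = y := Set.ext_iff.mp e1 ω
      simp only [Set.mem_ofPred_eq, h1, h2, h3, Prod.mk.injEq]
    have h := hX.markov k x
    have hxk : x k = y (Fin.last k) := by simp [hx, Fin.last]
    have hxk' : x (k + 1) = n := by simp [hx]
    rw [e1, e2, hxk, hxk'] at h
    rw [← ENNReal.ofReal_toReal (measure_ne_top P {ω | (Y ω, X (k + 1) ω) = (y, n)}),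
      ← measureReal_def, h, ENNReal.ofReal_mul measureReal_nonneg, measureReal_def,
      ENNReal.ofReal_toReal (measure_ne_top P _)]
  have hL : ∫⁻ ω, Z ω * f (X (k + 1) ω) ∂P =
      ∑' z : (Fin (k + 1) → ℕ) × ℕ, G z.1 * f z.2 * P {ω | (Y ω, X (k + 1) ω) = z} := by
    calc ∫⁻ ω, Z ω * f (X (k + 1) ω) ∂P
        = ∫⁻ z, G z.1 * f z.2 ∂(P.map fun ω => (Y ω, X (k + 1) ω)) := by
          rw [lintegral_map (measurable_of_countable _) hYX]
          simp_rw [hG]; rfl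
      _ = _ := by
          rw [lintegral_countable']
          refine tsum_congr fun z => ?_
          rw [Measure.map_apply hYX (measurableSet_singleton z)]; rfl
  have hR : ∫⁻ ω, Z ω * ∑' n, ENNReal.ofReal (p (X k ω) n) * f n ∂P =
      ∑' y, G y * (∑' n, ENNReal.ofReal (p (y (Fin.last k)) n) * f n) * P {ω | Y ω = y} := by
    calc ∫⁻ ω, Z ω * ∑' n, ENNReal.ofReal (p (X k ω) n) * f n ∂P
        = ∫⁻ y, G y * (∑' n, ENNReal.ofReal (p (y (Fin.last k)) n) * f n) ∂(P.map Y) := by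
          rw [lintegral_map (measurable_of_countable _) hY]
          simp_rw [hG]; rfl
      _ = _ := by
          rw [lintegral_countable']
          refine tsum_congr fun z => ?_
          rw [Measure.map_apply hY (measurableSet_singleton z)]; rfl
  rw [hL, hR, ENNReal.tsum_prod (f := fun y n => G y * f n * P {ω | (Y ω, X (k + 1) ω) = (y, n)})]
  refine tsum_congr fun y => ?_
  simp_rw [hmarkov]
  rw [← ENNReal.tsum_mul_left, ← ENNReal.tsum_mul_right]
  exact tsum_congr fun n => by ring

lemma IsMarkovChain.integrable_ite [IsFiniteMeasure P] {p : ℕ → ℕ → ℝ}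
    (hX : IsMarkovChain P X init p) (k n : ℕ) :
    Integrable (fun ω => if X k ω = n then (1 : ℝ) else 0) P := by
  refine Integrable.of_bound (C := 1) ((measurable_of_countable
    fun j : ℕ => if j = n then (1 : ℝ) else 0).comp (hX.measurable k)).aestronglyMeasurable
    (ae_of_all _ fun ω => ?_)
  split_ifs <;> simp

lemma IsMarkovChain.integral_ite {p : ℕ → ℕ → ℝ} (hX : IsMarkovChain P X init p) (k n : ℕ) :
    ∫ ω, (if X k ω = n then (1 : ℝ) else 0) ∂P = P.real {ω | X k ω = n} := by
  have hms : MeasurableSet {ω | X k ω = n} := hX.measurable k (measurableSet_singleton n)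
  rw [← integral_indicator_one hms]
  refine integral_congr_ae (ae_of_all _ fun ω => ?_)
  simp [Set.indicator_apply]

end

section
variable {q σ : ℝ} (hq0 : 0 ≤ q) (hq1 : q < 1) (hσ0 : 0 < σ) (hσ1 : σ ≤ 1)
include hq0 hq1 hσ0 hσ1

lemma tsum_chainTrans_mul {f : ℕ → ℝ} (hf : ∀ n, 0 ≤ f n) (m : ℕ) :
    ∑' n, ENNReal.ofReal (chainTrans q σ m n) * ENNReal.ofReal (f n) =
      ENNReal.ofReal (stepMean q σ f m) := by
  have hu := upProb_nonneg hq0 hq1 hσ0 hσ1 m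
  have hs := stayProb_nonneg hq0 hq1 hσ0 m
  have hd := downProb_nonneg hq0 hq1 hσ0 hσ1 m
  have h1 : ∀ n, ENNReal.ofReal (chainTrans q σ m n) * ENNReal.ofReal (f n) =
      (if n = m + 1 then ENNReal.ofReal (upProb q σ m * f n) else 0)
      + (if n = m then ENNReal.ofReal (stayProb q σ m * f n) else 0)
      + (if n + 1 = m then ENNReal.ofReal (downProb q σ m * f n) else 0) := by
    intro n
    rw [chainTrans_eq, ENNReal.ofReal_add (by split_ifs <;> positivity) (by split_ifs <;> simp [hd]),
      ENNReal.ofReal_add (by split_ifs <;> simp [hu]) (by split_ifs <;> simp [hs]), add_mul, add_mul]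
    congr 1
    · congr 1 <;> split_ifs <;> simp [ENNReal.ofReal_mul, hu, hs]
    · split_ifs <;> simp [ENNReal.ofReal_mul, hd]
  have h2 : ∑' n, (if n + 1 = m then ENNReal.ofReal (downProb q σ m * f n) else 0)
      = ENNReal.ofReal (downProb q σ m * f (m - 1)) := by
    rcases m with _ | m
    · simp [downProb_zero]
    · simp
  simp_rw [h1]
  rw [ENNReal.tsum_add, ENNReal.tsum_add, tsum_ite_eq, tsum_ite_eq, h2,
    ← ENNReal.ofReal_add (mul_nonneg hu (hf _)) (mul_nonneg hs (hf _)),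
    ← ENNReal.ofReal_add (add_nonneg (mul_nonneg hu (hf _)) (mul_nonneg hs (hf _)))
      (mul_nonneg hd (hf _))]
  rfl

lemma stepMean_nonneg {f : ℕ → ℝ} (hf : ∀ n, 0 ≤ f n) (m : ℕ) : 0 ≤ stepMean q σ f m :=
  add_nonneg (add_nonneg (mul_nonneg (upProb_nonneg hq0 hq1 hσ0 hσ1 m) (hf _))
    (mul_nonneg (stayProb_nonneg hq0 hq1 hσ0 m) (hf _)))
    (mul_nonneg (downProb_nonneg hq0 hq1 hσ0 hσ1 m) (hf _))

lemma stepMean_le_one {f : ℕ → ℝ} (hf : ∀ n, f n ≤ 1) (m : ℕ) : stepMean q σ f m ≤ 1 := by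
  rw [← prob_sum hq0 hq1 hσ0 hσ1 m]
  have h1 := mul_le_mul_of_nonneg_left (hf (m + 1)) (upProb_nonneg hq0 hq1 hσ0 hσ1 m)
  have h2 := mul_le_mul_of_nonneg_left (hf m) (stayProb_nonneg hq0 hq1 hσ0 m)
  have h3 := mul_le_mul_of_nonneg_left (hf (m - 1)) (downProb_nonneg hq0 hq1 hσ0 hσ1 m)
  simp only [stepMean]
  linarith

variable {Ω : Type*} [MeasurableSpace Ω] {P : Measure Ω} [IsProbabilityMeasure P]
  {X : ℕ → Ω → ℕ} {init : ℕ → ℝ} (hX : IsMarkovChain P X init (chainTrans q σ))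
include hX

lemma IsMarkovChain.integral_step {k : ℕ} {Z : Ω → ℝ} (hZ : DependsUpTo X k Z)
    (hZ0 : ∀ ω, 0 ≤ Z ω) {f : ℕ → ℝ} (hf : ∀ n, 0 ≤ f n) :
    ∫ ω, Z ω * f (X (k + 1) ω) ∂P = ∫ ω, Z ω * stepMean q σ f (X k ω) ∂P := by
  have hZm := hX.measurable_of_dependsUpTo hZ
  have hm : ∀ (g : ℕ → ℝ) (j : ℕ), AEStronglyMeasurable (fun ω => Z ω * g (X j ω)) P :=
    fun g j => (hZm.mul ((measurable_of_countable g).comp (hX.measurable j))).aestronglyMeasurable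
  rw [integral_eq_lintegral_of_nonneg_ae (ae_of_all _ fun ω => mul_nonneg (hZ0 ω) (hf _)) (hm _ _),
    integral_eq_lintegral_of_nonneg_ae (ae_of_all _ fun ω => mul_nonneg (hZ0 ω)
      (stepMean_nonneg hq0 hq1 hσ0 hσ1 hf _)) (hm _ _)]
  congr 1
  simp_rw [ENNReal.ofReal_mul (hZ0 _)]
  rw [hX.lintegral_step (Z := fun ω => ENNReal.ofReal (Z ω))
    (fun ω ω' h => by simp only [hZ ω ω' h]) (fun n => ENNReal.ofReal (f n))]
  simp_rw [tsum_chainTrans_mul hq0 hq1 hσ0 hσ1 hf]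

/-- The forward equation, from `integral_step` with Z = 1 and f the indicator of n. -/
lemma IsMarkovChain.measureReal_succ (k n : ℕ) :
    P.real {ω | X (k + 1) ω = n} =
      (if n = 0 then 0 else upProb q σ (n - 1) * P.real {ω | X k ω = n - 1})
      + stayProb q σ n * P.real {ω | X k ω = n}
      + downProb q σ (n + 1) * P.real {ω | X k ω = n + 1} := by
  have h := hX.integral_step hq0 hq1 hσ0 hσ1 (k := k) (Z := fun _ => 1) (fun _ _ _ => rfl)
    (fun _ => zero_le_one) (f := fun j => if j = n then (1 : ℝ) else 0)
    (fun j => by split_ifs <;> norm_num)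
  simp only [one_mul] at h
  rw [hX.integral_ite] at h
  rw [h]
  have hi := hX.integrable_ite k
  simp_rw [← hX.integral_ite k]
  rcases n with _ | n
  · have h1 : Integrable (fun ω => stayProb q σ 0 * if X k ω = 0 then (1 : ℝ) else 0) P :=
      (hi _).const_mul _
    have h2 : Integrable (fun ω => downProb q σ 1 * if X k ω = 0 + 1 then (1 : ℝ) else 0) P :=
      (hi _).const_mul _
    rw [if_pos rfl, zero_add, ← integral_const_mul, ← integral_const_mul, ← integral_add h1 h2]
    refine integral_congr_ae (ae_of_all _ fun ω => ?_)
    simp only [stepMean]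
    rcases X k ω with _ | _ | m <;> simp [downProb_zero]
  · have h1 : Integrable (fun ω => upProb q σ n * if X k ω = n then (1 : ℝ) else 0) P :=
      (hi _).const_mul _
    have h2 : Integrable (fun ω => stayProb q σ (n + 1) * if X k ω = n + 1 then (1 : ℝ) else 0) P :=
      (hi _).const_mul _
    have h3 : Integrable
        (fun ω => downProb q σ (n + 1 + 1) * if X k ω = n + 1 + 1 then (1 : ℝ) else 0) P :=
      (hi _).const_mul _
    rw [if_neg (Nat.succ_ne_zero n), ← integral_const_mul, ← integral_const_mul,
      ← integral_const_mul, Nat.add_sub_cancel, ← integral_add h1 h2,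
      ← integral_add (f := fun ω => _ + _) (h1.add h2) h3]
    refine integral_congr_ae (ae_of_all _ fun ω => ?_)
    simp only [stepMean]
    generalize X k ω = m
    have e1 : (if m + 1 = n + 1 then (1 : ℝ) else 0) * upProb q σ m =
        upProb q σ n * if m = n then 1 else 0 := by
      by_cases hm : m = n <;> simp [hm]
    have e2 : (if m = n + 1 then (1 : ℝ) else 0) * stayProb q σ m =
        stayProb q σ (n + 1) * if m = n + 1 then 1 else 0 := by
      by_cases hm : m = n + 1 <;> simp [hm]
    have e3 : (if m - 1 = n + 1 then (1 : ℝ) else 0) * downProb q σ m =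
        downProb q σ (n + 1 + 1) * if m = n + 1 + 1 then 1 else 0 := by
      rcases m with _ | m
      · simp
      · by_cases hm : m = n + 1 <;> simp [hm]
    rw [mul_comm (upProb q σ m), mul_comm (stayProb q σ m), mul_comm (downProb q σ m), e1, e2, e3]

/-- By detailed balance the weights are invariant, and the forward equation is monotone in the law,
so domination passes from time 0 to every time. -/
lemma IsMarkovChain.measureReal_le {D : ℝ} (hinit : ∀ n, init n ≤ D * revWeight q σ n) (k n : ℕ) :
    P.real {ω | X k ω = n} ≤ D * revWeight q σ n := by
  induction k generalizing n with
  | zero => rw [hX.initial]; exact hinit n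
  | succ k ih =>
    rw [hX.measureReal_succ hq0 hq1 hσ0 hσ1]
    have hs := stayProb_nonneg hq0 hq1 hσ0 n
    have hd := downProb_nonneg hq0 hq1 hσ0 hσ1 (n + 1)
    have h2 := mul_le_mul_of_nonneg_left (ih n) hs
    have h3 := mul_le_mul_of_nonneg_left (ih (n + 1)) hd
    have hb := detailed_balance hq0 hq1 hσ0 hσ1 n
    have hsum := prob_sum hq0 hq1 hσ0 hσ1 n
    have hD : D * revWeight q σ n = D * (revWeight q σ n *
      (upProb q σ n + stayProb q σ n + downProb q σ n)) := by rw [hsum, mul_one]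
    have key : (if n = 0 then 0 else upProb q σ (n - 1) * P.real {ω | X k ω = n - 1}) ≤
        D * (revWeight q σ n * downProb q σ n) := by
      rcases n with _ | n
      · simp [downProb_zero]
      · rw [if_neg (Nat.succ_ne_zero n), ← detailed_balance hq0 hq1 hσ0 hσ1 n]
        have := mul_le_mul_of_nonneg_left (ih n) (upProb_nonneg hq0 hq1 hσ0 hσ1 n)
        simp only [Nat.add_sub_cancel]
        linarith
    rw [hD]
    have e : D * (revWeight q σ n * (upProb q σ n + stayProb q σ n + downProb q σ n)) =
      D * (revWeight q σ n * downProb q σ n) + stayProb q σ n * (D * revWeight q σ n) +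
      D * (revWeight q σ n * upProb q σ n) := by ring
    rw [e, hb]
    linarith

/-- The states below M carry little mass when D is small; beyond M the function itself is small. The
bound is uniform in k. -/
lemma IsMarkovChain.integral_le_of_bound {D : ℝ} (hinit : ∀ n, init n ≤ D * revWeight q σ n)
    {e : ℕ → ℝ} (he0 : ∀ n, 0 ≤ e n) {B η : ℝ} (hB : ∀ n, e n ≤ B) {M : ℕ} (hη0 : 0 ≤ η)
    (hη : ∀ n, M ≤ n → e n ≤ η) (k : ℕ) :
    ∫ ω, e (X k ω) ∂P ≤ η + D * (B * ∑ n ∈ range M, revWeight q σ n) := by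
  have hB0 : 0 ≤ B := (he0 0).trans (hB 0)
  have hi := hX.integrable_ite k
  have hsum : Integrable (fun ω => B * ∑ n ∈ range M, if X k ω = n then (1 : ℝ) else 0) P :=
    (integrable_finsetSum _ fun j _ => hi j).const_mul B
  calc ∫ ω, e (X k ω) ∂P
      ≤ ∫ ω, (η + B * ∑ n ∈ range M, if X k ω = n then (1 : ℝ) else 0) ∂P := by
        refine integral_mono_of_nonneg (ae_of_all _ fun ω => he0 _)
          ((integrable_const η).add hsum) (ae_of_all _ fun ω => ?_)
        simp only [Finset.sum_ite_eq, Finset.mem_range]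
        split_ifs with h
        · linarith [hB (X k ω)]
        · linarith [hη (X k ω) (not_lt.mp h)]
    _ = η + B * ∑ n ∈ range M, P.real {ω | X k ω = n} := by
        rw [integral_add (integrable_const η) hsum, integral_const_mul,
          integral_finsetSum _ fun j _ => hi j]
        simp [hX.integral_ite]
    _ ≤ η + B * ∑ n ∈ range M, D * revWeight q σ n := by
        gcongr with n _
        exact hX.measureReal_le hq0 hq1 hσ0 hσ1 hinit k n
    _ = _ := by rw [← Finset.mul_sum]; ring

/-- A telescoping argument: the last chain step is traded for flow time h^2/(1+σ), which the
induction absorbs by letting τ vary. The factor Z in [0,1] does not enlarge the errors. -/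
lemma IsMarkovChain.abs_integral_sub_le {l h η : ℝ} (hl : 0 ≤ l) (h0 : 0 ≤ h) (h1 : h ≤ 1)
    (hη : ∀ k, ∫ ω, stepErr q σ (X k ω) ∂P ≤ η) {B : ℝ} (hB : ∀ n, stepErr q σ n ≤ B)
    {m : ℕ} {Z : Ω → ℝ} (hZ : DependsUpTo X m Z) (hZ0 : ∀ ω, 0 ≤ Z ω) (hZ1 : ∀ ω, Z ω ≤ 1)
    (n : ℕ) {τ : ℝ} (hτ : 0 ≤ τ) :
    |∫ ω, Z ω * gaussFlow l τ (X (m + n) ω * h) ∂P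
      - ∫ ω, Z ω * gaussFlow l (τ + n * (h ^ 2 / (1 + σ))) (X m ω * h) ∂P| ≤
      n * (stepConst l * h ^ 2 * (η + h)) := by
  induction n generalizing τ with
  | zero => simp
  | succ n ih =>
    have hτ' : 0 ≤ τ + h ^ 2 / (1 + σ) := by positivity
    have hih := ih hτ'
    have hZn : DependsUpTo X (m + n) Z := hZ.mono (Nat.le_add_right m n)
    have hZm := hX.measurable_of_dependsUpTo hZ
    have hstep := hX.integral_step hq0 hq1 hσ0 hσ1 hZn hZ0
      (f := fun k => gaussFlow l τ (k * h)) (fun k => (gaussFlow_pos hl hτ _).le)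
    rw [← add_assoc m n 1]
    rw [hstep]
    have hint : ∀ (g : ℕ → ℝ), (∀ k, 0 ≤ g k) → (∀ k, g k ≤ 1) →
        Integrable (fun ω => Z ω * g (X (m + n) ω)) P := by
      intro g hg0 hg1
      refine Integrable.of_bound (C := 1) (hZm.mul ((measurable_of_countable g).comp
        (hX.measurable (m + n)))).aestronglyMeasurable (ae_of_all _ fun ω => ?_)
      rw [Real.norm_of_nonneg (mul_nonneg (hZ0 ω) (hg0 _))]
      exact mul_le_one₀ (hZ1 ω) (hg0 _) (hg1 _)
    have i1 := hint (stepMean q σ fun k => gaussFlow l τ (k * h))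
      (stepMean_nonneg hq0 hq1 hσ0 hσ1 fun k => (gaussFlow_pos hl hτ _).le)
      (stepMean_le_one hq0 hq1 hσ0 hσ1 fun k => gaussFlow_le_one hl hτ _)
    have i2 := hint (fun k => gaussFlow l (τ + h ^ 2 / (1 + σ)) (k * h))
      (fun k => (gaussFlow_pos hl hτ' _).le) (fun k => gaussFlow_le_one hl hτ' _)
    have hC : 0 ≤ stepConst l * h ^ 2 := by unfold stepConst; positivity
    have ie : Integrable (fun ω => stepErr q σ (X (m + n) ω)) P := by
      refine Integrable.of_bound (C := B) ((measurable_of_countable (stepErr q σ)).comp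
        (hX.measurable (m + n))).aestronglyMeasurable (ae_of_all _ fun ω => ?_)
      rw [Real.norm_of_nonneg (stepErr_nonneg _ _ _)]
      exact hB _
    have hone : |∫ ω, Z ω * stepMean q σ (fun k => gaussFlow l τ (k * h)) (X (m + n) ω) ∂P
        - ∫ ω, Z ω * gaussFlow l (τ + h ^ 2 / (1 + σ)) (X (m + n) ω * h) ∂P| ≤
        stepConst l * h ^ 2 * (η + h) := by
      rw [← integral_sub i1 i2]
      refine (abs_integral_le_integral_abs).trans ?_
      calc _ ≤ ∫ ω, stepConst l * h ^ 2 * (stepErr q σ (X (m + n) ω) + h) ∂P := by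
            refine integral_mono_of_nonneg (ae_of_all _ fun ω => abs_nonneg _)
              ((ie.add (integrable_const h)).const_mul _) (ae_of_all _ fun ω => ?_)
            simp only
            rw [← mul_sub, abs_mul, abs_of_nonneg (hZ0 ω)]
            refine (mul_le_of_le_one_left (abs_nonneg _) (hZ1 ω)).trans ?_
            exact abs_stepMean_gaussFlow_sub_le hq0 hq1 hσ0 hσ1 hl hτ h0 h1 _
        _ = stepConst l * h ^ 2 * (∫ ω, stepErr q σ (X (m + n) ω) ∂P + h) := by
            rw [integral_const_mul, integral_add ie (integrable_const h)]; simp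
        _ ≤ _ := by gcongr; exact hη _
    have hτe : τ + (n + 1 : ℕ) * (h ^ 2 / (1 + σ)) = τ + h ^ 2 / (1 + σ) + n * (h ^ 2 / (1 + σ)) := by
      push_cast; ring
    rw [hτe]
    refine (abs_sub_le _ _ _).trans ((add_le_add hone hih).trans (le_of_eq ?_))
    push_cast; ring

end

end

noncomputable section

/-! ### The initial law -/

/-- The fibre over n is a cell of length h. Series thereby become integrals of step functions, open
to dominated convergence. -/
lemma map_floor_div_restrict {h : ℝ} (hh : 0 < h) :
    ((volume.restrict (Set.Ioi (0 : ℝ))).map fun x => ⌊x / h⌋₊) =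
      ENNReal.ofReal h • Measure.count := by
  have hm : Measurable fun x : ℝ => ⌊x / h⌋₊ := Nat.measurable_floor.comp (measurable_id.div_const h)
  refine Measure.ext_of_singleton fun n => ?_
  rw [Measure.map_apply hm (measurableSet_singleton n), Measure.smul_apply, Measure.count_singleton,
    restrict_Ioi_eq_restrict_Ici, Measure.restrict_apply (hm (measurableSet_singleton n))]
  have : (fun x : ℝ => ⌊x / h⌋₊) ⁻¹' {n} ∩ Set.Ici 0 = Set.Ico (n * h) ((n + 1) * h) := by
    ext x
    simp only [Set.mem_inter_iff, Set.mem_preimage, Set.mem_singleton_iff, Set.mem_Ici, Set.mem_Ico]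
    constructor
    · rintro ⟨h1, h2⟩
      rw [Nat.floor_eq_iff (by positivity), le_div_iff₀ hh, div_lt_iff₀ hh] at h1
      exact h1
    · rintro ⟨h1, h2⟩
      have h0 : 0 ≤ x := le_trans (by positivity) h1
      refine ⟨?_, h0⟩
      rw [Nat.floor_eq_iff (by positivity), le_div_iff₀ hh, div_lt_iff₀ hh]
      exact ⟨h1, h2⟩
  rw [this, Real.volume_Ico]
  simp only [smul_eq_mul, mul_one]
  congr 1; ring

lemma integral_floor_div {h : ℝ} (hh : 0 < h) {g : ℕ → ℝ}
    (hg : Integrable (fun x : ℝ => g ⌊x / h⌋₊) (volume.restrict (Set.Ioi 0))) :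
    ∫ x in Set.Ioi (0 : ℝ), g ⌊x / h⌋₊ = h * ∑' n, g n := by
  have hm : Measurable fun x : ℝ => ⌊x / h⌋₊ := Nat.measurable_floor.comp (measurable_id.div_const h)
  have hgm : AEStronglyMeasurable g ((volume.restrict (Set.Ioi (0 : ℝ))).map fun x => ⌊x / h⌋₊) :=
    (measurable_of_countable g).aestronglyMeasurable
  have hint := (integrable_map_measure hgm hm.aemeasurable).mpr hg
  rw [← integral_map hm.aemeasurable hgm, integral_countable hint, map_floor_div_restrict hh,
    ← tsum_mul_left]
  refine tsum_congr fun n => ?_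
  simp [measureReal_def, hh.le]

section
variable {c l : ℝ} (hc : 0 < c) (hl : 0 ≤ l)
include hc

lemma integrable_add_one_mul_exp :
    Integrable (fun x : ℝ => (x + 1) * Real.exp (-(c * x))) (volume.restrict (Set.Ioi 0)) := by
  have h := integrableOn_rpow_mul_exp_neg_mul_rpow (p := 1) (s := 1) (by norm_num) one_pos hc
  have h' := integrableOn_rpow_mul_exp_neg_mul_rpow (p := 1) (s := 0) (by norm_num) one_pos hc
  simp only [Real.rpow_one, Real.rpow_zero, one_mul] at h h'
  refine (h.add h').congr (ae_of_all _ fun x => ?_)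
  simp only [Pi.add_apply, neg_mul]
  ring

lemma integral_mul_exp_neg : ∫ x in Set.Ioi (0 : ℝ), x * Real.exp (-(c * x)) = 1 / c ^ 2 := by
  have h := Real.integral_rpow_mul_exp_neg_mul_Ioi (a := 2) (by norm_num) hc
  rw [Real.Gamma_two, mul_one] at h
  have h3 : (2 : ℝ) - 1 = 1 := by norm_num
  simp only [h3, Real.rpow_one] at h
  rw [h, Real.rpow_two]; ring

include hl in
-- One factor h is the mesh; the other rescales s_n, as h s_{⌊x/h⌋} tends to Kx.
lemma tendsto_riemann_sum {q σ K : ℝ} (hK : Tendsto (sDiff q σ) atTop (𝓝 K))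
    (hK' : ∀ n, sPrev q σ n ≤ K * n) (hS : ∀ n, 0 ≤ sPrev q σ n) :
    Tendsto (fun h : ℝ => h ^ 2 * ∑' n : ℕ, sSeq q σ n * Real.exp (-(c * (n * h))) *
        Real.exp (-(l * (n * h) ^ 2))) (𝓝[>] 0)
      (𝓝 (K * ∫ x in Set.Ioi (0 : ℝ), x * Real.exp (-(c * x)) * Real.exp (-(l * x ^ 2)))) := by
  have hK0 : 0 ≤ K := by have := (hS 1).trans (hK' 1); simpa using this
  set F : ℝ → ℝ → ℝ := fun h x => h * sSeq q σ ⌊x / h⌋₊ * Real.exp (-(c * (⌊x / h⌋₊ * h))) *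
        Real.exp (-(l * (⌊x / h⌋₊ * h) ^ 2)) with hF
  -- For h ≤ 1, rounding x down to the grid costs at most e^c in the exponential, and (⌊x/h⌋+1)h ≤
  -- x+1.
  set bound : ℝ → ℝ := fun x => K * Real.exp c * ((x + 1) * Real.exp (-(c * x))) with hb
  have hbound : Integrable bound (volume.restrict (Set.Ioi 0)) :=
    (integrable_add_one_mul_exp hc).const_mul _
  have hFm : ∀ h : ℝ, AEStronglyMeasurable (F h) (volume.restrict (Set.Ioi 0)) := by
    intro h
    have hm : Measurable fun x : ℝ => ⌊x / h⌋₊ :=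
      Nat.measurable_floor.comp (measurable_id.div_const h)
    exact ((measurable_of_countable fun n : ℕ => h * sSeq q σ n * Real.exp (-(c * (n * h))) *
        Real.exp (-(l * (n * h) ^ 2))).comp hm).aestronglyMeasurable
  have hfloor : ∀ {h x : ℝ}, 0 < h → 0 < x → ⌊x / h⌋₊ * h ≤ x ∧ x < ⌊x / h⌋₊ * h + h := by
    intro h x hh hx
    have h1 := Nat.floor_le (div_pos hx hh).le
    have h2 := Nat.lt_floor_add_one (x / h)
    rw [le_div_iff₀ hh] at h1
    rw [div_lt_iff₀ hh] at h2
    exact ⟨h1, by linarith⟩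
  have hFb : ∀ h ∈ Set.Ioc (0 : ℝ) 1, ∀ x ∈ Set.Ioi (0 : ℝ), ‖F h x‖ ≤ bound x := by
    intro h hh x hx
    obtain ⟨h1, h2⟩ := hfloor hh.1 hx
    have hs := hS (⌊x / h⌋₊ + 1)
    have hs' := hK' (⌊x / h⌋₊ + 1)
    rw [sPrev_succ] at hs hs'
    have hx0 : 0 < x := hx
    have hh0 : 0 < h := hh.1
    simp only [hF, hb]
    rw [Real.norm_of_nonneg (by positivity)]
    have e1 : h * sSeq q σ ⌊x / h⌋₊ ≤ K * (x + 1) := by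
      have := mul_le_mul_of_nonneg_left hs' hh.1.le
      have e : h * (K * (⌊x / h⌋₊ + 1 : ℕ)) = K * (⌊x / h⌋₊ * h + h) := by push_cast; ring
      rw [e] at this
      refine this.trans ?_
      gcongr
      exact hh.2
    have e2 : Real.exp (-(c * (⌊x / h⌋₊ * h))) ≤ Real.exp c * Real.exp (-(c * x)) := by
      rw [← Real.exp_add]
      refine Real.exp_le_exp.mpr ?_
      have := mul_le_mul_of_nonneg_left (show x - ⌊x / h⌋₊ * h ≤ 1 by linarith [hh.2]) hc.le
      linarith
    have e3 : Real.exp (-(l * (⌊x / h⌋₊ * h) ^ 2)) ≤ 1 := by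
      refine Real.exp_le_one_iff.mpr ?_
      have : 0 ≤ l * (⌊x / h⌋₊ * h) ^ 2 := by positivity
      linarith
    calc _ ≤ (K * (x + 1)) * (Real.exp c * Real.exp (-(c * x))) * 1 := by gcongr
      _ = _ := by ring
  have hlim : ∀ x ∈ Set.Ioi (0 : ℝ), Tendsto (fun h => F h x) (𝓝[>] 0)
      (𝓝 (x * K * Real.exp (-(c * x)) * Real.exp (-(l * x ^ 2)))) := by
    intro x hx
    have h0 : Tendsto (fun h : ℝ => h) (𝓝[>] 0) (𝓝 0) := tendsto_nhdsWithin_of_tendsto_nhds tendsto_id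
    have hfl : Tendsto (fun h : ℝ => (⌊x / h⌋₊ : ℝ) * h) (𝓝[>] 0) (𝓝 x) := by
      refine tendsto_of_tendsto_of_tendsto_of_le_of_le' (g := fun h => x - h) (h := fun _ => x)
        (by simpa using h0.const_sub x) tendsto_const_nhds ?_ ?_
      · filter_upwards [self_mem_nhdsWithin] with h hh
        linarith [(hfloor hh hx).2]
      · filter_upwards [self_mem_nhdsWithin] with h hh
        exact (hfloor hh hx).1
    have hfl' : Tendsto (fun h : ℝ => ((⌊x / h⌋₊ + 1 : ℕ) : ℝ) * h) (𝓝[>] 0) (𝓝 x) := by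
      have := hfl.add h0
      rw [add_zero] at this
      refine this.congr fun h => ?_
      push_cast; ring
    have hat : Tendsto (fun h : ℝ => ⌊x / h⌋₊ + 1) (𝓝[>] 0) atTop := by
      refine (tendsto_add_atTop_nat 1).comp (tendsto_nat_floor_atTop.comp ?_)
      exact tendsto_inv_nhdsGT_zero.const_mul_atTop (show 0 < x from hx)
    have hS' := (tendsto_sPrev_div hK).comp hat
    have hs1 : Tendsto (fun h => h * sSeq q σ ⌊x / h⌋₊) (𝓝[>] 0) (𝓝 (x * K)) := by
      refine (hfl'.mul hS').congr fun h => ?_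
      simp only [Function.comp, sPrev_succ]
      have : ((⌊x / h⌋₊ + 1 : ℕ) : ℝ) ≠ 0 := by positivity
      field_simp
    exact (hs1.mul (Real.continuous_exp.continuousAt.tendsto.comp (hfl.const_mul c).neg)).mul
      (Real.continuous_exp.continuousAt.tendsto.comp ((hfl.pow 2).const_mul l).neg)
  have hev : ∀ᶠ h : ℝ in 𝓝[>] 0, h ∈ Set.Ioc (0 : ℝ) 1 := by
    filter_upwards [Ioo_mem_nhdsGT (zero_lt_one' ℝ)] with h hh using ⟨hh.1, hh.2.le⟩
  have hdct := tendsto_integral_filter_of_dominated_convergence bound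
    (Eventually.of_forall hFm)
    (hev.mono fun h hh => (ae_restrict_iff' measurableSet_Ioi).mpr (ae_of_all _ (hFb h hh))) hbound
    ((ae_restrict_iff' measurableSet_Ioi).mpr (ae_of_all _ hlim))
  have hval : ∫ x in Set.Ioi (0 : ℝ), x * K * Real.exp (-(c * x)) * Real.exp (-(l * x ^ 2)) =
      K * ∫ x in Set.Ioi (0 : ℝ), x * Real.exp (-(c * x)) * Real.exp (-(l * x ^ 2)) := by
    rw [← integral_const_mul]
    exact integral_congr_ae (ae_of_all _ fun x => by ring)
  rw [hval] at hdct
  refine hdct.congr' (hev.mono fun h hh => ?_)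
  have hint : Integrable (F h) (volume.restrict (Set.Ioi 0)) :=
    Integrable.mono' hbound (hFm h)
      ((ae_restrict_iff' measurableSet_Ioi).mpr (ae_of_all _ (hFb h hh)))
  have := integral_floor_div hh.1 (g := fun n : ℕ => h * sSeq q σ n * Real.exp (-(c * (n * h))) *
        Real.exp (-(l * (n * h) ^ 2))) hint
  refine this.trans ?_
  simp_rw [mul_assoc h]
  rw [tsum_mul_left]
  ring

end

lemma IsMarkovChain.integral_zero {Ω : Type*} [MeasurableSpace Ω] {P : Measure Ω}
    {X : ℕ → Ω → ℕ} {init : ℕ → ℝ} {p : ℕ → ℕ → ℝ} [IsProbabilityMeasure P]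
    (hX : IsMarkovChain P X init p) {f : ℕ → ℝ} {B : ℝ} (hf : ∀ n, |f n| ≤ B) :
    ∫ ω, f (X 0 ω) ∂P = ∑' n, init n * f n := by
  have hm := hX.measurable 0
  have hfm : AEStronglyMeasurable f (P.map (X 0)) :=
    (measurable_of_countable f).aestronglyMeasurable
  have hint : Integrable f (P.map (X 0)) :=
    (integrable_map_measure hfm hm.aemeasurable).mpr
      (Integrable.of_bound (C := B) ((measurable_of_countable f).comp hm).aestronglyMeasurable
        (ae_of_all _ fun ω => hf _))
  rw [← integral_map hm.aemeasurable hfm, integral_countable hint]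
  refine tsum_congr fun n => ?_
  rw [measureReal_def, Measure.map_apply hm (measurableSet_singleton n), ← hX.initial n,
    smul_eq_mul]
  rfl

end

noncomputable section

/-! ### Gaussian integrals against the Bessel kernel -/

lemma integrable_sub_mul_exp {A : ℝ} (hA : 0 < A) (m : ℝ) :
    Integrable fun y : ℝ => y * Real.exp (-A * (y - m) ^ 2) := by
  have h1 : Integrable fun z : ℝ => (z + m) * Real.exp (-A * z ^ 2) := by
    simp_rw [add_mul]
    exact (integrable_mul_exp_neg_mul_sq hA).add ((integrable_exp_neg_mul_sq hA).const_mul m)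
  simpa using h1.comp_sub_right m

lemma integral_mul_exp_neg_sq_sub {A : ℝ} (hA : 0 < A) (m : ℝ) :
    ∫ y : ℝ, y * Real.exp (-A * (y - m) ^ 2) = m * √(Real.pi / A) := by
  have h1 := integrable_mul_exp_neg_mul_sq hA
  have h2 := (integrable_exp_neg_mul_sq hA).const_mul m
  have h3 : ∫ z : ℝ, z * Real.exp (-A * z ^ 2) = 0 := by
    have := integral_neg_eq_self (fun z : ℝ => z * Real.exp (-A * z ^ 2)) volume
    simp only [neg_mul, even_two.neg_pow] at this
    rw [integral_neg] at this
    simp only [neg_mul]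
    linarith
  have h4 := integral_sub_right_eq_self (fun z : ℝ => (z + m) * Real.exp (-A * z ^ 2)) m
    (μ := volume)
  simp only [sub_add_cancel] at h4
  rw [h4]
  simp_rw [add_mul]
  rw [integral_add h1 h2, h3, integral_const_mul, integral_gaussian, zero_add]

section
variable {l s x : ℝ} (hl : 0 ≤ l) (hs : 0 < s) (hx : 0 < x)
include hl hs

omit hl in
lemma killedBM_nonneg {x y : ℝ} (hx : 0 < x) (hy : 0 < y) : 0 ≤ killedBM s x y := by
  unfold killedBM
  refine mul_nonneg (by positivity) (sub_nonneg.mpr (Real.exp_le_exp.mpr (neg_le_neg ?_)))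
  gcongr ?_ / _
  nlinarith [mul_pos hx hy]

lemma gauss_complete_square (y : ℝ) :
    y * (Real.exp (-((y - x) ^ 2 / (2 * s))) * Real.exp (-(l * y ^ 2))) =
      Real.exp (-(gaussRate l s * x ^ 2)) *
        (y * Real.exp (-((1 + 2 * l * s) / (2 * s)) * (y - x / (1 + 2 * l * s)) ^ 2)) := by
  have hB := one_le_one_add_mul hl hs.le
  have hB0 : 1 + 2 * l * s ≠ 0 := by positivity
  rw [← Real.exp_add, mul_left_comm, ← Real.exp_add, gaussRate]
  congr 2
  field_simp
  ring

lemma gaussScale_eq : gaussScale l s = 1 / ((1 + 2 * l * s) * √(1 + 2 * l * s)) := by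
  have hB := one_le_one_add_mul hl hs.le
  have hB0 : 0 < 1 + 2 * l * s := by positivity
  rw [gaussScale, Real.rpow_neg hB0.le, one_div, Real.sqrt_eq_rpow]
  congr 1
  nth_rewrite 2 [← Real.rpow_one (1 + 2 * l * s)]
  rw [← Real.rpow_add hB0]
  norm_num

include hx

/-- Method of images: up to a constant the integrand is f(y) + f(-y), so the half-line integral
unfolds to the first moment of one Gaussian on the whole line. This identifies `gaussFlow` with the
Bessel semigroup. -/
lemma integrable_and_integral_bessel :
    IntegrableOn (fun y => y / x * killedBM s x y * Real.exp (-(l * y ^ 2))) (Set.Ioi 0) ∧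
    ∫ y in Set.Ioi (0 : ℝ), y / x * killedBM s x y * Real.exp (-(l * y ^ 2)) =
      gaussFlow l s x := by
  have hB := one_le_one_add_mul hl hs.le
  have hB0 : 0 < 1 + 2 * l * s := by positivity
  set f : ℝ → ℝ := fun y => y * (Real.exp (-((y - x) ^ 2 / (2 * s))) * Real.exp (-(l * y ^ 2)))
    with hf
  have hA : 0 < (1 + 2 * l * s) / (2 * s) := by positivity
  have hfi : Integrable f := by
    simp_rw [hf, gauss_complete_square hl hs]
    exact (integrable_sub_mul_exp hA _).const_mul _
  have hfi' : Integrable (fun y => f (-y)) := hfi.comp_neg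
  have hsplit : ∀ y, y / x * killedBM s x y * Real.exp (-(l * y ^ 2)) =
      1 / (x * √(2 * Real.pi * s)) * (f y + f (-y)) := by
    intro y
    simp only [hf, killedBM]
    have : (-y - x) ^ 2 = (y + x) ^ 2 := by ring
    rw [this, even_two.neg_pow]
    field_simp
    ring
  simp_rw [hsplit]
  refine ⟨((hfi.add hfi').const_mul _).integrableOn, ?_⟩
  rw [integral_const_mul, integral_add hfi.integrableOn hfi'.integrableOn,
    integral_comp_neg_Ioi, neg_zero, add_comm,
    intervalIntegral.integral_Iic_add_Ioi hfi.integrableOn hfi.integrableOn]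
  simp_rw [hf, gauss_complete_square hl hs]
  rw [integral_const_mul, integral_mul_exp_neg_sq_sub hA, gaussFlow, gaussScale_eq hl hs]
  have e : Real.pi / ((1 + 2 * l * s) / (2 * s)) = 2 * Real.pi * s / (1 + 2 * l * s) := by
    field_simp
  have h2 : 0 < √(2 * Real.pi * s) := Real.sqrt_pos.mpr (by positivity)
  have h3 : 0 < √(1 + 2 * l * s) := Real.sqrt_pos.mpr hB0
  rw [e, Real.sqrt_div (by positivity)]
  field_simp

end

section
variable {σ t x l : ℝ} (hσ0 : 0 < σ) (ht : 0 < t) (hx : 0 < x) (hl : 0 ≤ l)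
include hσ0 ht hx

lemma besselDensity_nonneg {y : ℝ} (hy : 0 < y) : 0 ≤ besselDensity σ t x y :=
  mul_nonneg (by positivity) (killedBM_nonneg (by positivity) hx hy)

include hl in
lemma lintegral_besselDensity :
    ∫⁻ y in Set.Ioi (0 : ℝ), ENNReal.ofReal (besselDensity σ t x y) *
        ENNReal.ofReal (Real.exp (-(l * y ^ 2))) =
      ENNReal.ofReal (gaussFlow l (t / (1 + σ)) x) := by
  have hs : 0 < t / (1 + σ) := by positivity
  obtain ⟨h1, h2⟩ := integrable_and_integral_bessel hl hs hx
  rw [← h2, ofReal_integral_eq_lintegral_ofReal h1]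
  · refine setLIntegral_congr_fun measurableSet_Ioi fun y hy => ?_
    rw [← ENNReal.ofReal_mul (besselDensity_nonneg hσ0 ht hx hy)]
    rfl
  · refine (ae_restrict_iff' measurableSet_Ioi).mpr (ae_of_all _ fun y hy => ?_)
    exact mul_nonneg (besselDensity_nonneg hσ0 ht hx hy) (Real.exp_pos _).le

end

@[fun_prop]
lemma measurable_besselDensity {α : Type*} [MeasurableSpace α] (σ t : ℝ) {f g : α → ℝ}
    (hf : Measurable f) (hg : Measurable g) : Measurable fun a => besselDensity σ t (f a) (g a) := by
  unfold besselDensity killedBM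
  fun_prop

/-! ### The joint Laplace functional -/

/-- The function `exp (-∑ l_i x_i²)`. -/
def gaussWeight {d : ℕ} (l x : Fin d → ℝ) : ℝ := Real.exp (-∑ i, l i * x i ^ 2)

/-- The weights that remain after the last coordinate has been integrated out. -/
def peelWeight (σ : ℝ) {d : ℕ} (t : Fin (d + 2) → ℝ≥0) (l : Fin (d + 2) → ℝ) : Fin (d + 1) → ℝ :=
  fun i => l i.castSucc + if i = Fin.last d then gaussRate (l (Fin.last (d + 1)))
    (((t (Fin.last (d + 1)) : ℝ) - t (Fin.last d).castSucc) / (1 + σ)) else 0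

/-- The expectation of `exp (-∑ l_i ξ_{t_i}²)`. -/
def besselLaplace (σ c : ℝ) : (d : ℕ) → (Fin (d + 1) → ℝ≥0) → (Fin (d + 1) → ℝ) → ℝ
  | 0, _, l => c ^ 2 * ∫ x in Set.Ioi (0 : ℝ), x * Real.exp (-(c * x)) * Real.exp (-(l 0 * x ^ 2))
  | d + 1, t, l => gaussScale (l (Fin.last (d + 1)))
      (((t (Fin.last (d + 1)) : ℝ) - t (Fin.last d).castSucc) / (1 + σ)) *
      besselLaplace σ c d (fun i => t i.castSucc) (peelWeight σ t l)

lemma gaussWeight_succ {d : ℕ} (l x : Fin (d + 1) → ℝ) :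
    gaussWeight l x = gaussWeight (fun i => l i.castSucc) (fun i => x i.castSucc) *
      Real.exp (-(l (Fin.last d) * x (Fin.last d) ^ 2)) := by
  rw [gaussWeight, gaussWeight, Fin.sum_univ_castSucc, neg_add, Real.exp_add]

/-- The closure property behind `besselLaplace`: the flow is again Gaussian in the last remaining
coordinate, so its rate joins that weight. -/
lemma gaussWeight_mul_gaussFlow (σ : ℝ) {d : ℕ} (t : Fin (d + 2) → ℝ≥0) (l : Fin (d + 2) → ℝ)
    (x : Fin (d + 1) → ℝ) :
    gaussWeight (fun i => l i.castSucc) x * gaussFlow (l (Fin.last (d + 1)))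
      (((t (Fin.last (d + 1)) : ℝ) - t (Fin.last d).castSucc) / (1 + σ)) (x (Fin.last d)) =
      gaussScale (l (Fin.last (d + 1)))
        (((t (Fin.last (d + 1)) : ℝ) - t (Fin.last d).castSucc) / (1 + σ)) *
        gaussWeight (peelWeight σ t l) x := by
  simp only [gaussWeight, peelWeight, gaussFlow, add_mul, Finset.sum_add_distrib, ite_mul, zero_mul,
    Finset.sum_ite_eq', Finset.mem_univ, if_true, neg_add, Real.exp_add]
  ring

lemma gaussWeight_pos {d : ℕ} (l x : Fin d → ℝ) : 0 < gaussWeight l x := Real.exp_pos _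

lemma gaussWeight_le_one {d : ℕ} {l : Fin d → ℝ} (hl : ∀ i, 0 ≤ l i) (x : Fin d → ℝ) :
    gaussWeight l x ≤ 1 := by
  refine Real.exp_le_one_iff.mpr (neg_nonpos.mpr (Finset.sum_nonneg fun i _ => ?_))
  exact mul_nonneg (hl i) (sq_nonneg _)

@[fun_prop]
lemma measurable_gaussWeight {d : ℕ} (l : Fin d → ℝ) : Measurable (gaussWeight l) := by
  unfold gaussWeight
  fun_prop

lemma sub_div_nonneg_of_strictMono {σ : ℝ} (hσ0 : 0 < σ) {d : ℕ} {t : Fin (d + 2) → ℝ≥0}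
    (ht : StrictMono t) :
    0 ≤ ((t (Fin.last (d + 1)) : ℝ) - t (Fin.last d).castSucc) / (1 + σ) := by
  have h : t (Fin.last d).castSucc ≤ t (Fin.last (d + 1)) := ht.monotone (Fin.le_last _)
  have h' : (t (Fin.last d).castSucc : ℝ) ≤ t (Fin.last (d + 1)) := by exact_mod_cast h
  exact div_nonneg (sub_nonneg.mpr h') (by linarith)

lemma peelWeight_nonneg {σ : ℝ} (hσ0 : 0 < σ) {d : ℕ} {t : Fin (d + 2) → ℝ≥0}
    (ht : StrictMono t) {l : Fin (d + 2) → ℝ} (hl : ∀ i, 0 ≤ l i) (i : Fin (d + 1)) :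
    0 ≤ peelWeight σ t l i := by
  unfold peelWeight
  have := gaussRate_nonneg (hl (Fin.last (d + 1))) (sub_div_nonneg_of_strictMono hσ0 ht)
  have := hl i.castSucc
  split_ifs <;> positivity

lemma strictMono_castSucc {d : ℕ} {t : Fin (d + 2) → ℝ≥0} (ht : StrictMono t) :
    StrictMono fun i : Fin (d + 1) => t i.castSucc :=
  fun _ _ h => ht (Fin.castSucc_lt_castSucc_iff.mpr h)

/-- Zero weights stay zero under peeling; this gives the total mass of the joint law. -/
lemma besselLaplace_zero {σ c : ℝ} (hc : 0 < c) (d : ℕ) (t : Fin (d + 1) → ℝ≥0) :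
    besselLaplace σ c d t 0 = 1 := by
  induction d with
  | zero =>
    simp only [besselLaplace, Pi.zero_apply, zero_mul, neg_zero, Real.exp_zero, mul_one]
    rw [integral_mul_exp_neg hc]
    field_simp
  | succ d ih =>
    have : peelWeight σ t 0 = 0 := by funext i; simp [peelWeight, gaussRate]
    rw [besselLaplace, this, ih]
    simp [gaussScale]

lemma lintegral_initial {c l : ℝ} (hc : 0 < c) (hl : 0 ≤ l) :
    ∫⁻ x in Set.Ioi (0 : ℝ), ENNReal.ofReal (c ^ 2 * x * Real.exp (-(c * x))) *
        ENNReal.ofReal (Real.exp (-(l * x ^ 2))) =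
      ENNReal.ofReal (c ^ 2 *
        ∫ x in Set.Ioi (0 : ℝ), x * Real.exp (-(c * x)) * Real.exp (-(l * x ^ 2))) := by
  rw [← integral_const_mul, ofReal_integral_eq_lintegral_ofReal]
  · refine setLIntegral_congr_fun measurableSet_Ioi fun x hx => ?_
    have hx' : 0 < x := hx
    rw [← ENNReal.ofReal_mul (by positivity)]
    congr 1; ring
  · refine ((integrable_add_one_mul_exp hc).const_mul (c ^ 2)).mono' (by fun_prop) ?_
    refine (ae_restrict_iff' measurableSet_Ioi).mpr (ae_of_all _ fun x hx => ?_)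
    have hx' : 0 < x := hx
    rw [Real.norm_of_nonneg (by positivity)]
    have h1 : Real.exp (-(l * x ^ 2)) ≤ 1 := Real.exp_le_one_iff.mpr (by
      have : 0 ≤ l * x ^ 2 := by positivity
      linarith)
    have h2 := Real.exp_pos (-(c * x))
    refine mul_le_mul_of_nonneg_left ?_ (by positivity)
    calc x * Real.exp (-(c * x)) * Real.exp (-(l * x ^ 2)) ≤ x * Real.exp (-(c * x)) * 1 := by gcongr
      _ ≤ (x + 1) * Real.exp (-(c * x)) := by rw [mul_one]; gcongr; linarith
  · refine (ae_restrict_iff' measurableSet_Ioi).mpr (ae_of_all _ fun x hx => ?_)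
    have hx' : 0 < x := hx
    show 0 ≤ _
    positivity

/-- The density of the joint law. -/
def jointDensity (σ c : ℝ) {d : ℕ} (t : Fin (d + 1) → ℝ≥0) (x : Fin (d + 1) → ℝ) : ℝ :=
  c ^ 2 * x 0 * Real.exp (-(c * x 0)) *
    ∏ i : Fin d, besselDensity σ ((t i.succ : ℝ) - t i.castSucc) (x i.castSucc) (x i.succ)

@[fun_prop]
lemma measurable_jointDensity (σ c : ℝ) {d : ℕ} (t : Fin (d + 1) → ℝ≥0) :
    Measurable (jointDensity σ c t) := by
  unfold jointDensity
  fun_prop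

lemma jointDensity_succ (σ c : ℝ) {d : ℕ} (t : Fin (d + 2) → ℝ≥0) (x : Fin (d + 2) → ℝ) :
    jointDensity σ c t x = jointDensity σ c (fun i => t i.castSucc) (fun i => x i.castSucc) *
      besselDensity σ ((t (Fin.last (d + 1)) : ℝ) - t (Fin.last d).castSucc)
        (x (Fin.last d).castSucc) (x (Fin.last (d + 1))) := by
  rw [jointDensity, Fin.prod_univ_castSucc, ← mul_assoc]
  rfl

lemma jointDensity_nonneg {σ c : ℝ} (hσ0 : 0 < σ) {d : ℕ} {t : Fin (d + 1) → ℝ≥0}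
    (ht : StrictMono t) {x : Fin (d + 1) → ℝ} (hx : ∀ i, 0 < x i) : 0 ≤ jointDensity σ c t x := by
  refine mul_nonneg (mul_nonneg (mul_nonneg (sq_nonneg c) (hx 0).le) (Real.exp_pos _).le)
    (Finset.prod_nonneg fun i _ => ?_)
  refine besselDensity_nonneg hσ0 (sub_pos.mpr ?_) (hx _) (hx _)
  exact_mod_cast ht (Fin.castSucc_lt_succ)

lemma besselJointLaw_eq (σ c : ℝ) {d : ℕ} (t : Fin (d + 1) → ℝ≥0) :
    besselJointLaw σ c t = (Measure.pi fun _ : Fin (d + 1) =>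
      (volume : Measure ℝ).restrict (Set.Ioi 0)).withDensity
        fun x => ENNReal.ofReal (jointDensity σ c t x) := by
  rw [← Measure.restrict_pi_pi, ← volume_pi]
  have : {x : Fin (d + 1) → ℝ | ∀ i, 0 < x i} = Set.univ.pi fun _ => Set.Ioi 0 := by
    ext x; simp
  rw [besselJointLaw, this]
  rfl

lemma ae_pi_restrict_Ioi_pos (d : ℕ) : ∀ᵐ x ∂(Measure.pi fun _ : Fin d =>
    (volume : Measure ℝ).restrict (Set.Ioi 0)), ∀ i, 0 < x i := by
  rw [← Measure.restrict_pi_pi, ae_restrict_iff' (MeasurableSet.univ_pi fun _ => measurableSet_Ioi)]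
  exact ae_of_all _ fun x hx i => hx i (Set.mem_univ i)

/-- Tonelli with the last coordinate innermost, where the Bessel kernel acts on a Gaussian; the
result is the same integral with one coordinate fewer and peeled weights. -/
lemma lintegral_jointDensity {σ c : ℝ} (hσ0 : 0 < σ) (hc : 0 < c) (d : ℕ)
    {t : Fin (d + 1) → ℝ≥0} (ht : StrictMono t) {l : Fin (d + 1) → ℝ} (hl : ∀ i, 0 ≤ l i) :
    ∫⁻ x, ENNReal.ofReal (jointDensity σ c t x) * ENNReal.ofReal (gaussWeight l x)
        ∂(Measure.pi fun _ : Fin (d + 1) => (volume : Measure ℝ).restrict (Set.Ioi 0)) =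
      ENNReal.ofReal (besselLaplace σ c d t l) := by
  induction d with
  | zero =>
    have hmp := measurePreserving_funUnique ((volume : Measure ℝ).restrict (Set.Ioi 0)) (Fin 1)
    rw [besselLaplace, ← lintegral_initial hc (hl 0),
      ← hmp.lintegral_comp (f := fun x : ℝ => ENNReal.ofReal (c ^ 2 * x * Real.exp (-(c * x))) *
        ENNReal.ofReal (Real.exp (-(l 0 * x ^ 2)))) (by fun_prop)]
    refine lintegral_congr fun x => ?_
    simp [jointDensity, gaussWeight]
  | succ d ih =>
    set τ := ((t (Fin.last (d + 1)) : ℝ) - t (Fin.last d).castSucc) / (1 + σ) with hτ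
    have hτ0 : 0 < (t (Fin.last (d + 1)) : ℝ) - t (Fin.last d).castSucc := by
      refine sub_pos.mpr ?_
      exact_mod_cast ht (Fin.castSucc_lt_last _)
    have hmp := measurePreserving_piFinSuccAbove
      (fun _ : Fin (d + 2) => (volume : Measure ℝ).restrict (Set.Ioi 0)) (Fin.last (d + 1))
    set F : ℝ × (Fin (d + 1) → ℝ) → ℝ≥0∞ := fun z =>
      ENNReal.ofReal (jointDensity σ c (fun i => t i.castSucc) z.2 *
        besselDensity σ ((t (Fin.last (d + 1)) : ℝ) - t (Fin.last d).castSucc)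
          (z.2 (Fin.last d)) z.1) *
      ENNReal.ofReal (gaussWeight (fun i => l i.castSucc) z.2 *
        Real.exp (-(l (Fin.last (d + 1)) * z.1 ^ 2))) with hF
    have hFm : Measurable F := by
      have h1 : Measurable fun z : ℝ × (Fin (d + 1) → ℝ) =>
          jointDensity σ c (fun i => t i.castSucc) z.2 :=
        (measurable_jointDensity σ c _).comp measurable_snd
      have h2 : Measurable fun z : ℝ × (Fin (d + 1) → ℝ) =>
          gaussWeight (fun i => l i.castSucc) z.2 :=
        (measurable_gaussWeight _).comp measurable_snd
      simp only [hF]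
      fun_prop
    calc _ = ∫⁻ x, F (MeasurableEquiv.piFinSuccAbove (fun _ => ℝ) (Fin.last (d + 1)) x)
          ∂(Measure.pi fun _ : Fin (d + 2) => (volume : Measure ℝ).restrict (Set.Ioi 0)) := by
          refine lintegral_congr fun x => ?_
          have hr : (Fin.last (d + 1)).removeNth x = fun i => x i.castSucc := by
            funext i; simp [Fin.removeNth]
          rw [jointDensity_succ, gaussWeight_succ]
          simp only [hF, MeasurableEquiv.piFinSuccAbove_apply, Fin.insertNthEquiv,
            Equiv.coe_fn_symm_mk, hr]
      _ = ∫⁻ y, (∫⁻ z in Set.Ioi (0 : ℝ), F (z, y))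
          ∂(Measure.pi fun _ : Fin (d + 1) => (volume : Measure ℝ).restrict (Set.Ioi 0)) := by
          rw [hmp.lintegral_comp hFm, lintegral_prod_symm' _ hFm]
      _ = ∫⁻ y, ENNReal.ofReal (gaussScale (l (Fin.last (d + 1))) τ) *
            (ENNReal.ofReal (jointDensity σ c (fun i => t i.castSucc) y) *
            ENNReal.ofReal (gaussWeight (peelWeight σ t l) y))
          ∂(Measure.pi fun _ : Fin (d + 1) => (volume : Measure ℝ).restrict (Set.Ioi 0)) := by
          refine lintegral_congr_ae ?_
          filter_upwards [ae_pi_restrict_Ioi_pos (d + 1)] with y hy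
          have hD := jointDensity_nonneg (c := c) hσ0 (strictMono_castSucc ht) hy
          have hW := (gaussWeight_pos (fun i : Fin (d + 1) => l i.castSucc) y).le
          have h1 : ∀ z, F (z, y) = ENNReal.ofReal (jointDensity σ c (fun i => t i.castSucc) y) *
              ENNReal.ofReal (gaussWeight (fun i => l i.castSucc) y) *
              (ENNReal.ofReal (besselDensity σ ((t (Fin.last (d + 1)) : ℝ)
                - t (Fin.last d).castSucc) (y (Fin.last d)) z) *
              ENNReal.ofReal (Real.exp (-(l (Fin.last (d + 1)) * z ^ 2)))) := by
            intro z
            simp only [hF]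
            rw [ENNReal.ofReal_mul hD, ENNReal.ofReal_mul hW]
            ring
          simp_rw [h1]
          rw [lintegral_const_mul _ (by fun_prop),
            lintegral_besselDensity hσ0 hτ0 (hy _) (hl _), mul_assoc, ← ENNReal.ofReal_mul hW,
            gaussWeight_mul_gaussFlow, ENNReal.ofReal_mul
              (gaussScale_pos (hl _) (sub_div_nonneg_of_strictMono hσ0 ht)).le]
          ring
      _ = _ := by
          rw [lintegral_const_mul _ (by fun_prop),
            ih (strictMono_castSucc ht) (peelWeight_nonneg hσ0 ht hl), besselLaplace,
            ENNReal.ofReal_mul (gaussScale_pos (hl _) (sub_div_nonneg_of_strictMono hσ0 ht)).le]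

lemma lintegral_besselJointLaw {σ c : ℝ} (hσ0 : 0 < σ) (hc : 0 < c) (d : ℕ)
    {t : Fin (d + 1) → ℝ≥0} (ht : StrictMono t) {l : Fin (d + 1) → ℝ} (hl : ∀ i, 0 ≤ l i) :
    ∫⁻ x, ENNReal.ofReal (gaussWeight l x) ∂(besselJointLaw σ c t) =
      ENNReal.ofReal (besselLaplace σ c d t l) := by
  rw [besselJointLaw_eq, lintegral_withDensity_eq_lintegral_mul _ (by fun_prop) (by fun_prop)]
  exact lintegral_jointDensity hσ0 hc d ht hl

lemma isProbabilityMeasure_besselJointLaw {σ c : ℝ} (hσ0 : 0 < σ) (hc : 0 < c) {d : ℕ}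
    {t : Fin (d + 1) → ℝ≥0} (ht : StrictMono t) :
    IsProbabilityMeasure (besselJointLaw σ c t) := by
  have h := lintegral_besselJointLaw hσ0 hc d ht (l := 0) fun _ => le_rfl
  rw [besselLaplace_zero hc] at h
  refine ⟨?_⟩
  simpa [gaussWeight] using h

lemma ae_besselJointLaw_pos (σ c : ℝ) {d : ℕ} (t : Fin (d + 1) → ℝ≥0) :
    ∀ᵐ x ∂(besselJointLaw σ c t), ∀ i, 0 < x i := by
  rw [besselJointLaw_eq]
  exact (withDensity_absolutelyContinuous _ _).ae_le (ae_pi_restrict_Ioi_pos (d + 1))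

end

noncomputable section

/-! ### The Laplace functional of the limit process -/

lemma isProbabilityMeasure_besselTrans {σ t x : ℝ} (hσ0 : 0 < σ) (ht : 0 < t) (hx : 0 < x) :
    IsProbabilityMeasure (besselTrans σ t x) := by
  have h := lintegral_besselDensity hσ0 ht hx le_rfl
  refine ⟨?_⟩
  rw [besselTrans, withDensity_apply _ MeasurableSet.univ, Measure.restrict_univ]
  simpa [gaussFlow, gaussScale, gaussRate] using h

lemma besselTrans_Iic (σ t x : ℝ) : besselTrans σ t x (Set.Iic 0) = 0 := by
  refine withDensity_absolutelyContinuous _ _ ?_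
  rw [Measure.restrict_apply measurableSet_Iic, Set.Iic_inter_Ioi, Set.Ioc_self, measure_empty]

lemma besselInit_Iic (c : ℝ) : besselInit c (Set.Iic 0) = 0 := by
  refine withDensity_absolutelyContinuous _ _ ?_
  rw [Measure.restrict_apply measurableSet_Iic, Set.Iic_inter_Ioi, Set.Ioc_self, measure_empty]

lemma measurable_besselTrans (σ t : ℝ) : Measurable (besselTrans σ t) := by
  refine Measure.measurable_of_measurable_coe _ fun A hA => ?_
  simp only [besselTrans, withDensity_apply _ hA]
  exact Measurable.lintegral_prod_right' (f := fun z : ℝ × ℝ =>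
    ENNReal.ofReal (besselDensity σ t z.1 z.2)) (by fun_prop)

lemma lintegral_besselTrans {σ t x l : ℝ} (hσ0 : 0 < σ) (ht : 0 < t) (hx : 0 < x) (hl : 0 ≤ l) :
    ∫⁻ y, ENNReal.ofReal (Real.exp (-(l * y ^ 2))) ∂(besselTrans σ t x) =
      ENNReal.ofReal (gaussFlow l (t / (1 + σ)) x) := by
  rw [besselTrans, lintegral_withDensity_eq_lintegral_mul _ (by fun_prop) (by fun_prop)]
  exact lintegral_besselDensity hσ0 ht hx hl

/-- The events up to time `s`. -/
@[reducible]
def pastSpace {Ω : Type*} (ξ : ℝ≥0 → Ω → ℝ) (s : ℝ≥0) : MeasurableSpace Ω :=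
  ⨆ u : Set.Iic s, MeasurableSpace.comap (ξ u) inferInstance

section
variable {Ω : Type*} [MeasurableSpace Ω] {P : Measure Ω} [IsProbabilityMeasure P]
  {ξ : ℝ≥0 → Ω → ℝ} {σ c : ℝ}
  (hξ : IsMarkovProcess P ξ (besselInit c) (besselTrans σ))
include hξ

/-- Neither the initial law nor any transition law charges (-∞, 0]. Needed because `besselTrans` is
shown to be a probability only from positive starting points. -/
lemma IsMarkovProcess.ae_pos (s : ℝ≥0) : ∀ᵐ ω ∂P, 0 < ξ s ω := by
  have hnull : P (ξ s ⁻¹' Set.Iic 0) = 0 := by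
    rcases eq_or_ne s 0 with rfl | hs
    · rw [← Measure.map_apply (hξ.measurable 0) measurableSet_Iic, hξ.initial, besselInit_Iic]
    · have h := hξ.markov 0 s (pos_iff_ne_zero.mpr hs) (Set.Iic 0) measurableSet_Iic
      have hle : (⨆ u : Set.Iic (0 : ℝ≥0), MeasurableSpace.comap (ξ u) inferInstance) ≤
          (inferInstance : MeasurableSpace Ω) := iSup_le fun u => (hξ.measurable u).comap_le
      have hms := hξ.measurable s (measurableSet_Iic (a := (0 : ℝ)))
      have h1 := integral_condExp hle (μ := P)
        (f := (ξ s ⁻¹' Set.Iic 0).indicator fun _ => (1 : ℝ))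
      rw [integral_congr_ae h] at h1
      simp only [measureReal_def, besselTrans_Iic, ENNReal.toReal_zero, integral_zero] at h1
      rw [integral_indicator_const _ hms, smul_eq_mul, mul_one] at h1
      exact (measureReal_eq_zero_iff).mp h1.symm
  have : ∀ᵐ ω ∂P, ω ∉ ξ s ⁻¹' Set.Iic 0 := measure_eq_zero_iff_ae_notMem.mp hnull
  filter_upwards [this] with ω hω
  simpa using hω

/-- The Markov property speaks of events only. Under the measure Z·P it says that the law of ξ_t is
a mixture of transition laws, and this equality of measures can be integrated against a Gaussian. -/
lemma IsMarkovProcess.lintegral_mul_exp (hσ0 : 0 < σ) {s t : ℝ≥0} (hst : s < t) {Z : Ω → ℝ}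
    (hZ : Measurable[pastSpace ξ s] Z)
    (hZ0 : ∀ ω, 0 ≤ Z ω) (hZ1 : ∀ ω, Z ω ≤ 1) {l : ℝ} (hl : 0 ≤ l) :
    ∫⁻ ω, ENNReal.ofReal (Z ω) * ENNReal.ofReal (Real.exp (-(l * ξ t ω ^ 2))) ∂P =
      ∫⁻ ω, ENNReal.ofReal (Z ω) *
        ENNReal.ofReal (gaussFlow l (((t : ℝ) - s) / (1 + σ)) (ξ s ω)) ∂P := by
  have hle : pastSpace ξ s ≤ (inferInstance : MeasurableSpace Ω) :=
    iSup_le fun u => (hξ.measurable u).comap_le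
  have hZm : Measurable Z := hZ.mono hle le_rfl
  have hts : 0 < (t : ℝ) - s := sub_pos.mpr (by exact_mod_cast hst)
  have hκ : Measurable fun ω => besselTrans σ ((t : ℝ) - s) (ξ s ω) :=
    (measurable_besselTrans σ _).comp (hξ.measurable s)
  set ν := P.withDensity fun ω => ENNReal.ofReal (Z ω) with hν
  have hνP : ν ≪ P := withDensity_absolutelyContinuous _ _
  have hmeas : ν.map (ξ t) = ν.bind fun ω => besselTrans σ ((t : ℝ) - s) (ξ s ω) := by
    ext A hA
    have hAt := hξ.measurable t hA
    have hκA : Measurable fun ω => besselTrans σ ((t : ℝ) - s) (ξ s ω) A :=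
      (Measure.measurable_coe hA).comp hκ
    rw [Measure.map_apply (hξ.measurable t) hA, Measure.bind_apply hA hκ.aemeasurable,
      ← lintegral_indicator_one hAt, hν,
      lintegral_withDensity_eq_lintegral_mul _ (by fun_prop) (measurable_one.indicator hAt),
      lintegral_withDensity_eq_lintegral_mul _ (by fun_prop) hκA]
    set g : Ω → ℝ := (ξ t ⁻¹' A).indicator fun _ => (1 : ℝ) with hg
    have hgi : Integrable g P := (integrable_const 1).indicator hAt
    have hbound : ∀ᵐ ω ∂P, ‖Z ω‖ ≤ 1 := ae_of_all _ fun ω => by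
      rw [Real.norm_of_nonneg (hZ0 ω)]; exact hZ1 ω
    -- Z is measurable for the past, so it factors out of the conditional expectation.
    have hpull := condExp_stronglyMeasurable_mul_of_bound hle hZ.stronglyMeasurable hgi 1 hbound
    have hcond := hξ.markov s t hst A hA
    have hkey : ∫ ω, Z ω * g ω ∂P =
        ∫ ω, Z ω * (besselTrans σ ((t : ℝ) - s) (ξ s ω)).real A ∂P := by
      have h1 := integral_condExp hle (μ := P) (f := Z * g)
      simp only [Pi.mul_apply] at h1
      rw [← h1, integral_congr_ae hpull]
      refine integral_congr_ae ?_
      filter_upwards [hcond] with ω hω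
      rw [Pi.mul_apply, hω]
    have hreal : ∀ᵐ ω ∂P, besselTrans σ ((t : ℝ) - s) (ξ s ω) A =
        ENNReal.ofReal ((besselTrans σ ((t : ℝ) - s) (ξ s ω)).real A) := by
      filter_upwards [hξ.ae_pos s] with ω hω
      have := isProbabilityMeasure_besselTrans hσ0 hts hω
      rw [ofReal_measureReal]
    have hL : ∫⁻ ω, ENNReal.ofReal (Z ω) * (ξ t ⁻¹' A).indicator 1 ω ∂P =
        ENNReal.ofReal (∫ ω, Z ω * g ω ∂P) := by
      rw [ofReal_integral_eq_lintegral_ofReal (hgi.bdd_mul hZm.aestronglyMeasurable hbound)]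
      · refine lintegral_congr fun ω => ?_
        rw [ENNReal.ofReal_mul (hZ0 ω)]
        by_cases hω : ω ∈ ξ t ⁻¹' A <;> simp [hg, hω]
      · refine ae_of_all _ fun ω => mul_nonneg (hZ0 ω) ?_
        exact Set.indicator_nonneg (fun _ _ => zero_le_one) ω
    have hR : ∫⁻ ω, ENNReal.ofReal (Z ω) * besselTrans σ ((t : ℝ) - s) (ξ s ω) A ∂P =
        ENNReal.ofReal (∫ ω, Z ω * (besselTrans σ ((t : ℝ) - s) (ξ s ω)).real A ∂P) := by
      rw [ofReal_integral_eq_lintegral_ofReal]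
      · refine lintegral_congr_ae ?_
        filter_upwards [hreal] with ω hω
        rw [ENNReal.ofReal_mul (hZ0 ω), hω]
      · refine Integrable.of_bound (C := 1) ?_ ?_
        · exact (hZm.mul hκA.ennreal_toReal).aestronglyMeasurable
        · filter_upwards [hξ.ae_pos s] with ω hω
          have := isProbabilityMeasure_besselTrans hσ0 hts hω
          rw [Real.norm_of_nonneg (mul_nonneg (hZ0 ω) measureReal_nonneg)]
          exact mul_le_one₀ (hZ1 ω) measureReal_nonneg measureReal_le_one
      · exact ae_of_all _ fun ω => mul_nonneg (hZ0 ω) measureReal_nonneg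
    simp only [Pi.mul_apply]
    rw [hL, hR, hkey]
  have hf : Measurable fun y : ℝ => ENNReal.ofReal (Real.exp (-(l * y ^ 2))) := by fun_prop
  have hgm : Measurable fun ω => ENNReal.ofReal (gaussFlow l (((t : ℝ) - s) / (1 + σ)) (ξ s ω)) := by
    have := hξ.measurable s
    unfold gaussFlow
    fun_prop
  have hξt := hξ.measurable t
  have e1 : ∫⁻ ω, ENNReal.ofReal (Real.exp (-(l * ξ t ω ^ 2))) ∂ν =
      ∫⁻ ω, ENNReal.ofReal (gaussFlow l (((t : ℝ) - s) / (1 + σ)) (ξ s ω)) ∂ν := by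
    rw [← lintegral_map hf (hξ.measurable t), hmeas, Measure.lintegral_bind hκ.aemeasurable
      hf.aemeasurable]
    refine lintegral_congr_ae (hνP.ae_le ?_)
    filter_upwards [hξ.ae_pos s] with ω hω
    exact lintegral_besselTrans hσ0 hts hω hl
  rw [hν, lintegral_withDensity_eq_lintegral_mul _ (by fun_prop) (by fun_prop),
    lintegral_withDensity_eq_lintegral_mul _ (by fun_prop) hgm] at e1
  exact e1

lemma IsMarkovProcess.lintegral_gaussWeight (hσ0 : 0 < σ) (hc : 0 < c) (d : ℕ)
    {t : Fin (d + 1) → ℝ≥0} (ht0 : t 0 = 0) (ht : StrictMono t) {l : Fin (d + 1) → ℝ}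
    (hl : ∀ i, 0 ≤ l i) :
    ∫⁻ ω, ENNReal.ofReal (gaussWeight l fun i => ξ (t i) ω) ∂P =
      ENNReal.ofReal (besselLaplace σ c d t l) := by
  induction d with
  | zero =>
    rw [besselLaplace, ← lintegral_initial hc (hl 0)]
    have hf : Measurable fun y : ℝ => ENNReal.ofReal (Real.exp (-(l 0 * y ^ 2))) := by fun_prop
    have h1 : ∀ ω, ENNReal.ofReal (gaussWeight l fun i => ξ (t i) ω) =
        ENNReal.ofReal (Real.exp (-(l 0 * ξ 0 ω ^ 2))) := fun ω => by simp [gaussWeight, ht0]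
    simp_rw [h1]
    rw [← lintegral_map hf (hξ.measurable 0), hξ.initial, besselInit,
      lintegral_withDensity_eq_lintegral_mul _ (by fun_prop) hf]
    rfl
  | succ d ih =>
    have hst : t (Fin.last d).castSucc < t (Fin.last (d + 1)) := ht (Fin.castSucc_lt_last _)
    have hl' : ∀ i : Fin (d + 1), 0 ≤ l i.castSucc := fun i => hl _
    have hZ : Measurable[pastSpace ξ (t (Fin.last d).castSucc)]
        fun ω => gaussWeight (fun i : Fin (d + 1) => l i.castSucc)
          fun i => ξ (t i.castSucc) ω := by
      refine (measurable_gaussWeight _).comp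
        (@measurable_pi_lambda _ _ _ (pastSpace ξ (t (Fin.last d).castSucc)) _ _ fun i => ?_)
      have hi : t i.castSucc ≤ t (Fin.last d).castSucc :=
        (strictMono_castSucc ht).monotone (Fin.le_last i)
      exact (comap_measurable (ξ (t i.castSucc))).mono
        (le_iSup (fun u : Set.Iic (t (Fin.last d).castSucc) =>
          MeasurableSpace.comap (ξ u) inferInstance) ⟨t i.castSucc, hi⟩) le_rfl
    have h := hξ.lintegral_mul_exp hσ0 hst hZ (fun ω => (gaussWeight_pos _ _).le)
      (fun ω => gaussWeight_le_one hl' _) (hl (Fin.last (d + 1)))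
    have hs := (gaussScale_pos (hl (Fin.last (d + 1)))
      (sub_div_nonneg_of_strictMono hσ0 ht)).le
    have hξm : Measurable fun ω (i : Fin (d + 1)) => ξ (t i.castSucc) ω :=
      measurable_pi_lambda _ fun i => hξ.measurable _
    have hW : Measurable fun x => ENNReal.ofReal (gaussWeight (peelWeight σ t l) x) := by fun_prop
    rw [besselLaplace, ENNReal.ofReal_mul hs, ← ih (by simpa using ht0) (strictMono_castSucc ht)
      (peelWeight_nonneg hσ0 ht hl), ← lintegral_const_mul _
        (show Measurable fun ω => ENNReal.ofReal (gaussWeight (peelWeight σ t l)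
          fun i => ξ (t i.castSucc) ω) from hW.comp hξm)]
    simp_rw [gaussWeight_succ (d := d + 1)]
    simp_rw [ENNReal.ofReal_mul (gaussWeight_pos _ _).le]
    rw [h]
    refine lintegral_congr fun ω => ?_
    rw [← ENNReal.ofReal_mul (gaussWeight_pos _ _).le, ← ENNReal.ofReal_mul hs,
      gaussWeight_mul_gaussFlow σ t l fun i => ξ (t i.castSucc) ω]

end

end

noncomputable section

/-! ### Convergence of Gaussian Laplace functionals implies weak convergence -/

open BoundedContinuousFunction

/-- The function `x ↦ exp (-∑ l_i x_i²)` on the positive orthant. -/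
def gaussBCF {d : ℕ} (l : Fin d → ℝ≥0) : (Fin d → ℝ≥0) →ᵇ ℝ :=
  BoundedContinuousFunction.ofNormedAddCommGroup
    (fun x => gaussWeight (fun i => (l i : ℝ)) fun i => (x i : ℝ))
    (by unfold gaussWeight; fun_prop) 1 fun x => by
      rw [Real.norm_of_nonneg (gaussWeight_pos _ _).le]
      exact gaussWeight_le_one (fun i => (l i).coe_nonneg) _

lemma gaussBCF_apply {d : ℕ} (l x : Fin d → ℝ≥0) :
    gaussBCF l x = gaussWeight (fun i => (l i : ℝ)) fun i => (x i : ℝ) := rfl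

lemma gaussBCF_mul {d : ℕ} (l l' : Fin d → ℝ≥0) :
    gaussBCF l * gaussBCF l' = gaussBCF (l + l') := by
  ext x
  simp only [BoundedContinuousFunction.mul_apply, gaussBCF_apply, gaussWeight, ← Real.exp_add]
  congr 1
  simp only [Pi.add_apply, NNReal.coe_add, add_mul, Finset.sum_add_distrib]
  ring

lemma gaussBCF_zero {d : ℕ} : (gaussBCF 0 : (Fin d → ℝ≥0) →ᵇ ℝ) = 1 := by
  ext x
  simp [gaussBCF_apply, gaussWeight]

/-- The algebra spanned by the Gaussian functions. -/
def gaussAlgebra (d : ℕ) : StarSubalgebra ℝ ((Fin d → ℝ≥0) →ᵇ ℝ) where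
  carrier := (Submodule.span ℝ (Set.range (gaussBCF (d := d))) : Set ((Fin d → ℝ≥0) →ᵇ ℝ))
  mul_mem' {a b} ha hb := by
    have h := Submodule.mul_mem_mul (SetLike.mem_coe.mp ha) (SetLike.mem_coe.mp hb)
    rw [Submodule.span_mul_span] at h
    refine Submodule.span_mono ?_ h
    rintro _ ⟨_, ⟨l, rfl⟩, _, ⟨l', rfl⟩, rfl⟩
    exact ⟨l + l', (gaussBCF_mul l l').symm⟩
  add_mem' ha hb := Submodule.add_mem _ ha hb
  algebraMap_mem' r := by
    rw [Algebra.algebraMap_eq_smul_one]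
    exact Submodule.smul_mem _ r (Submodule.subset_span ⟨0, gaussBCF_zero⟩)
  star_mem' {a} ha := by
    have : star a = a := by ext x; simp
    rw [this]; exact ha

lemma mem_gaussAlgebra_iff {d : ℕ} {g : (Fin d → ℝ≥0) →ᵇ ℝ} :
    g ∈ gaussAlgebra d ↔ g ∈ Submodule.span ℝ (Set.range (gaussBCF (d := d))) := Iff.rfl

lemma gaussBCF_mem_gaussAlgebra {d : ℕ} (l : Fin d → ℝ≥0) : gaussBCF l ∈ gaussAlgebra d :=
  mem_gaussAlgebra_iff.mpr (Submodule.subset_span ⟨l, rfl⟩)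

/-- Squares separate points only on the nonnegative orthant, hence the passage to `ℝ≥0`. -/
lemma separatesPoints_gaussAlgebra (d : ℕ) :
    ((gaussAlgebra d).map (toContinuousMapStarₐ ℝ)).SeparatesPoints := by
  intro x y hxy
  obtain ⟨i, hi⟩ := Function.ne_iff.mp hxy
  refine ⟨gaussBCF (Pi.single i 1), ?_, ?_⟩
  · simp only [StarSubalgebra.coe_toSubalgebra, StarSubalgebra.coe_map, Set.mem_image,
      SetLike.mem_coe, exists_exists_and_eq_and]
    exact ⟨gaussBCF (Pi.single i 1), gaussBCF_mem_gaussAlgebra _, rfl⟩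
  · have h : ∀ z : Fin d → ℝ≥0, gaussBCF (Pi.single i 1) z = Real.exp (-(z i : ℝ) ^ 2) := by
      intro z
      rw [gaussBCF_apply, gaussWeight, Finset.sum_eq_single i]
      · simp
      · intro j _ hj
        simp [Pi.single_eq_of_ne hj]
      · simp
    change gaussBCF (Pi.single i 1) x ≠ gaussBCF (Pi.single i 1) y
    rw [h, h]
    intro he
    have h2 := Real.exp_injective he
    rw [neg_inj, sq_eq_sq₀ (x i).coe_nonneg (y i).coe_nonneg] at h2
    exact hi (NNReal.coe_injective h2)

section
variable {d : ℕ}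

/-- Outside the box some coordinate exceeds r, so the Gaussian is at most e^(-1) ≤ 1/2 and 2(1 - g)
dominates the indicator. -/
lemma measure_compl_Icc_le (μ : Measure (Fin d → ℝ≥0)) [IsProbabilityMeasure μ] {r : ℝ≥0}
    (hr : 0 < r) : μ (Set.Icc 0 fun _ => r)ᶜ ≤
      ENNReal.ofReal (2 * (1 - ∫ x, gaussBCF (fun _ => (r ^ 2)⁻¹) x ∂μ)) := by
  set g := gaussBCF (d := d) fun _ => (r ^ 2)⁻¹
  have hg : Integrable (fun x => g x) μ := g.integrable μ
  have hg1 : ∀ x, g x ≤ 1 := fun x => gaussWeight_le_one (fun i => NNReal.coe_nonneg _) _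
  have hms : MeasurableSet (Set.Icc (0 : Fin d → ℝ≥0) fun _ => r)ᶜ := measurableSet_Icc.compl
  have hle : ∀ x ∈ (Set.Icc (0 : Fin d → ℝ≥0) fun _ => r)ᶜ, 1 ≤ 2 * (1 - g x) := by
    intro x hx
    have : ∃ i, r < x i := by
      by_contra hcon
      push Not at hcon
      exact hx ⟨zero_le, hcon⟩
    obtain ⟨i, hi⟩ := this
    have hr' : (0 : ℝ) < r := by exact_mod_cast hr
    have hi' : (r : ℝ) < x i := by exact_mod_cast hi
    have h1 : 1 ≤ ∑ j, ((r ^ 2)⁻¹ : ℝ≥0) * (x j : ℝ) ^ 2 := by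
      have h2 : ((r ^ 2)⁻¹ : ℝ≥0) * (x i : ℝ) ^ 2 ≤ ∑ j, ((r ^ 2)⁻¹ : ℝ≥0) * (x j : ℝ) ^ 2 :=
        Finset.single_le_sum (f := fun j => (((r ^ 2)⁻¹ : ℝ≥0) : ℝ) * (x j : ℝ) ^ 2)
          (fun j _ => by positivity) (Finset.mem_univ i)
      refine le_trans ?_ h2
      push_cast
      rw [inv_mul_eq_div, one_le_div (by positivity)]
      gcongr
    have h3 : g x ≤ Real.exp (-1) := Real.exp_le_exp.mpr (neg_le_neg h1)
    have h4 : Real.exp (-1) ≤ 1 / 2 := by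
      rw [Real.exp_neg, one_div]
      exact inv_anti₀ two_pos (by have := Real.add_one_le_exp 1; linarith)
    linarith
  have hint : Integrable (fun x => 2 * (1 - g x)) μ := ((integrable_const 1).sub hg).const_mul 2
  rw [← ofReal_measureReal]
  refine ENNReal.ofReal_le_ofReal ?_
  calc μ.real (Set.Icc (0 : Fin d → ℝ≥0) fun _ => r)ᶜ
      = ∫ x, (Set.Icc (0 : Fin d → ℝ≥0) fun _ => r)ᶜ.indicator 1 x ∂μ :=
        (integral_indicator_one hms).symm
    _ ≤ ∫ x, 2 * (1 - g x) ∂μ := by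
        refine integral_mono_of_nonneg
          (ae_of_all _ fun x => Set.indicator_nonneg (fun _ _ => zero_le_one) x) hint
          (ae_of_all _ fun x => ?_)
        by_cases hx : x ∈ (Set.Icc (0 : Fin d → ℝ≥0) fun _ => r)ᶜ
        · rw [Set.indicator_of_mem hx]; exact hle x hx
        · rw [Set.indicator_of_notMem hx]; have := hg1 x; simp only; linarith
    _ = _ := by
        rw [integral_const_mul, integral_sub (integrable_const 1) hg]
        simp

lemma tendsto_integral_gaussBCF_inv_sq (μ : Measure (Fin d → ℝ≥0)) [IsProbabilityMeasure μ] :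
    Tendsto (fun n : ℕ => ∫ x, gaussBCF (fun _ => (((n + 1 : ℕ) : ℝ≥0) ^ 2)⁻¹) x ∂μ) atTop
      (𝓝 1) := by
  have h1 : ∫ _ : Fin d → ℝ≥0, (1 : ℝ) ∂μ = 1 := by simp
  rw [← h1]
  refine tendsto_integral_of_dominated_convergence (fun _ => 1)
    (fun n => (gaussBCF _).continuous.aestronglyMeasurable) (integrable_const 1)
    (fun n => ae_of_all _ fun x => ?_) (ae_of_all _ fun x => ?_)
  · rw [gaussBCF_apply, Real.norm_of_nonneg (gaussWeight_pos _ _).le]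
    exact gaussWeight_le_one (fun i => NNReal.coe_nonneg _) _
  · have h2 : Tendsto (fun n : ℕ => (((n + 1 : ℕ) : ℝ) ^ 2)⁻¹) atTop (𝓝 0) :=
      (tendsto_pow_atTop two_ne_zero).inv_tendsto_atTop.comp
        (tendsto_natCast_atTop_atTop.comp (tendsto_add_atTop_nat 1))
    have h3 : Tendsto (fun n : ℕ => -∑ i, (((n + 1 : ℕ) : ℝ) ^ 2)⁻¹ * (x i : ℝ) ^ 2) atTop
        (𝓝 (-∑ i : Fin d, 0 * (x i : ℝ) ^ 2)) :=
      (tendsto_finsetSum _ fun i _ => h2.mul_const _).neg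
    have h4 := (Real.continuous_exp.tendsto _).comp h3
    simp only [zero_mul, Finset.sum_const_zero, neg_zero, Real.exp_zero] at h4
    refine h4.congr fun n => ?_
    simp [gaussBCF_apply, gaussWeight]

/-- A wide Gaussian has integral near 1 under the limit, hence under all but finitely many μ N; the
others are tight one by one. -/
lemma isTightMeasureSet_of_tendsto_gaussBCF {μ : ℕ+ → ProbabilityMeasure (Fin d → ℝ≥0)}
    {μ₀ : ProbabilityMeasure (Fin d → ℝ≥0)}
    (h : ∀ l, Tendsto (fun N => ∫ x, gaussBCF l x ∂(μ N : Measure (Fin d → ℝ≥0))) atTop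
      (𝓝 (∫ x, gaussBCF l x ∂(μ₀ : Measure (Fin d → ℝ≥0))))) :
    IsTightMeasureSet {(μ N : Measure (Fin d → ℝ≥0)) | N} := by
  rw [isTightMeasureSet_iff_exists_isCompact_measure_compl_le]
  intro ε hε
  obtain ⟨e, he0, he⟩ : ∃ e : ℝ, 0 < e ∧ ENNReal.ofReal e ≤ ε := by
    rcases eq_or_ne ε ⊤ with rfl | htop
    · exact ⟨1, one_pos, le_top⟩
    · exact ⟨ε.toReal, ENNReal.toReal_pos hε.ne' htop, ENNReal.ofReal_toReal_le⟩
  have h1 : ∀ᶠ n : ℕ in atTop, 1 - e / 2 < ∫ x, gaussBCF (fun _ => (((n + 1 : ℕ) : ℝ≥0) ^ 2)⁻¹) x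
      ∂(μ₀ : Measure (Fin d → ℝ≥0)) :=
    (tendsto_integral_gaussBCF_inv_sq (μ₀ : Measure (Fin d → ℝ≥0))).eventually_const_lt
      (by linarith)
  obtain ⟨n, hn⟩ := h1.exists
  obtain ⟨N₀, hN₀⟩ := eventually_atTop.mp ((h _).eventually_const_lt hn)
  have h2 : ∀ N, ∃ K : Set (Fin d → ℝ≥0), IsCompact K ∧
      (μ N : Measure (Fin d → ℝ≥0)) Kᶜ ≤ ε := by
    intro N
    have := isTightMeasureSet_iff_exists_isCompact_measure_compl_le.mp
      (isTightMeasureSet_singleton (μ := (μ N : Measure (Fin d → ℝ≥0)))) ε hε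
    obtain ⟨K, hK, hK'⟩ := this
    exact ⟨K, hK, hK' _ rfl⟩
  choose K hK hK' using h2
  refine ⟨(Set.Icc 0 fun _ => ((n + 1 : ℕ) : ℝ≥0)) ∪ ⋃ N ∈ Finset.Iio N₀, K N,
    isCompact_Icc.union ((Finset.Iio N₀).isCompact_biUnion fun N _ => hK N), ?_⟩
  rintro _ ⟨N, rfl⟩
  rcases lt_or_ge N N₀ with hN | hN
  · refine (measure_mono (Set.compl_subset_compl.mpr ?_)).trans (hK' N)
    exact Set.subset_union_of_subset_right
      (Set.subset_biUnion_of_mem (u := K) (show N ∈ Finset.Iio N₀ from Finset.mem_Iio.mpr hN)) _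
  · refine (measure_mono (Set.compl_subset_compl.mpr Set.subset_union_left)).trans ?_
    refine (measure_compl_Icc_le _ (by positivity)).trans (le_trans ?_ he)
    refine ENNReal.ofReal_le_ofReal ?_
    linarith [hN₀ N hN]

lemma tendsto_of_tendsto_gaussBCF {μ : ℕ+ → ProbabilityMeasure (Fin d → ℝ≥0)}
    {μ₀ : ProbabilityMeasure (Fin d → ℝ≥0)}
    (h : ∀ l, Tendsto (fun N => ∫ x, gaussBCF l x ∂(μ N : Measure (Fin d → ℝ≥0))) atTop
      (𝓝 (∫ x, gaussBCF l x ∂(μ₀ : Measure (Fin d → ℝ≥0))))) :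
    Tendsto μ atTop (𝓝 μ₀) := by
  refine ProbabilityMeasure.tendsto_of_tight_of_separatesPoints ℝ
    (isTightMeasureSet_of_tendsto_gaussBCF h) (separatesPoints_gaussAlgebra d) fun g hg => ?_
  rw [mem_gaussAlgebra_iff] at hg
  induction hg using Submodule.span_induction with
  | mem g hg => obtain ⟨l, rfl⟩ := hg; exact h l
  | zero => simp
  | add f g hf hg ihf ihg =>
    simp only [BoundedContinuousFunction.add_apply]
    simp_rw [integral_add (f.integrable _) (g.integrable _)]
    exact ihf.add ihg
  | smul r f hf ih =>
    simp only [BoundedContinuousFunction.smul_apply, smul_eq_mul, integral_const_mul]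
    exact ih.const_mul r

end

/-- Nonnegative random vectors converge in distribution if their Gaussian Laplace functionals
converge. -/
lemma tendstoInDistribution_of_tendsto_gaussWeight {d : ℕ} {Ω : ℕ+ → Type*}
    [∀ N, MeasurableSpace (Ω N)] {P : ∀ N, Measure (Ω N)} [∀ N, IsProbabilityMeasure (P N)]
    {Ω' : Type*} [MeasurableSpace Ω'] {P' : Measure Ω'} [IsProbabilityMeasure P']
    {Y : ∀ N, Ω N → Fin d → ℝ} {W : Ω' → Fin d → ℝ} (hY : ∀ N, Measurable (Y N))
    (hW : Measurable W) (hY0 : ∀ N ω i, 0 ≤ Y N ω i) (hW0 : ∀ᵐ ω ∂P', ∀ i, 0 ≤ W ω i)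
    (h : ∀ l : Fin d → ℝ, (∀ i, 0 ≤ l i) →
      Tendsto (fun N => ∫ ω, gaussWeight l (Y N ω) ∂(P N)) atTop
        (𝓝 (∫ ω, gaussWeight l (W ω) ∂P'))) :
    TendstoInDistribution Y atTop W P P' := by
  have hc : Continuous fun (x : Fin d → ℝ≥0) i => (x i : ℝ) := by fun_prop
  -- The argument runs on the orthant and returns to `ℝ` through the continuous coercion; W is
  -- nonnegative only almost surely, which suffices.
  set Y' : ∀ N, Ω N → Fin d → ℝ≥0 := fun N ω i => (Y N ω i).toNNReal with hY'
  set W' : Ω' → Fin d → ℝ≥0 := fun ω i => (W ω i).toNNReal with hW'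
  have hYm : ∀ N, Measurable (Y' N) := fun N =>
    measurable_pi_lambda _ fun i => ((measurable_pi_apply i).comp (hY N)).real_toNNReal
  have hWm : Measurable W' :=
    measurable_pi_lambda _ fun i => ((measurable_pi_apply i).comp hW).real_toNNReal
  have key : TendstoInDistribution Y' atTop W' P P' := by
    refine ⟨fun N => (hYm N).aemeasurable, hWm.aemeasurable, ?_⟩
    refine tendsto_of_tendsto_gaussBCF fun l => ?_
    have e1 : ∀ N, ∫ x, gaussBCF l x ∂((P N).map (Y' N)) =
        ∫ ω, gaussWeight (fun i => (l i : ℝ)) (Y N ω) ∂(P N) := by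
      intro N
      rw [integral_map (hYm N).aemeasurable (gaussBCF l).continuous.aestronglyMeasurable]
      refine integral_congr_ae (ae_of_all _ fun ω => ?_)
      simp only [gaussBCF_apply, hY']
      congr 1
      funext i
      exact Real.coe_toNNReal _ (hY0 N ω i)
    have e2 : ∫ x, gaussBCF l x ∂(P'.map W') =
        ∫ ω, gaussWeight (fun i => (l i : ℝ)) (W ω) ∂P' := by
      rw [integral_map hWm.aemeasurable (gaussBCF l).continuous.aestronglyMeasurable]
      refine integral_congr_ae ?_
      filter_upwards [hW0] with ω hω
      simp only [gaussBCF_apply, hW']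
      congr 1
      funext i
      exact Real.coe_toNNReal _ (hω i)
    have := h (fun i => (l i : ℝ)) fun i => (l i).coe_nonneg
    simp_rw [← e1, ← e2] at this
    exact this
  refine TendstoInDistribution.congr (fun N => ae_of_all _ fun ω => ?_) ?_
    (key.continuous_comp hc)
  · funext i
    exact Real.coe_toNNReal _ (hY0 N ω i)
  · filter_upwards [hW0] with ω hω
    funext i
    exact Real.coe_toNNReal _ (hω i)

end

noncomputable section

/-! ### Convergence of the Laplace functionals of the chain -/

lemma besselLaplace_nonneg {σ c : ℝ} (hσ0 : 0 < σ) (d : ℕ) {t : Fin (d + 1) → ℝ≥0}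
    (ht : StrictMono t) {l : Fin (d + 1) → ℝ} (hl : ∀ i, 0 ≤ l i) :
    0 ≤ besselLaplace σ c d t l := by
  induction d with
  | zero =>
    refine mul_nonneg (sq_nonneg c) (setIntegral_nonneg measurableSet_Ioi fun x hx => ?_)
    have hx' : 0 < x := hx
    positivity
  | succ d ih =>
    exact mul_nonneg (gaussScale_pos (hl _) (sub_div_nonneg_of_strictMono hσ0 ht)).le
      (ih (strictMono_castSucc ht) (peelWeight_nonneg hσ0 ht hl))

lemma tendsto_pnat_cast : Tendsto (fun N : ℕ+ => ((N : ℕ) : ℝ)) atTop atTop := by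
  refine tendsto_natCast_atTop_atTop.comp (tendsto_atTop.mpr fun b => ?_)
  filter_upwards [eventually_ge_atTop (⟨b + 1, Nat.succ_pos b⟩ : ℕ+)] with N hN
  have h : b + 1 ≤ (N : ℕ) := hN
  omega

lemma tendsto_inv_sqrt_pnat : Tendsto (fun N : ℕ+ => (√((N : ℕ) : ℝ))⁻¹) atTop (𝓝[>] 0) := by
  refine tendsto_nhdsWithin_iff.mpr ⟨?_, Eventually.of_forall fun N => ?_⟩
  · exact (Real.tendsto_sqrt_atTop.comp tendsto_pnat_cast).inv_tendsto_atTop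
  · have : (0 : ℝ) < (N : ℕ) := by exact_mod_cast N.pos
    exact inv_pos.mpr (Real.sqrt_pos.mpr this)

section
variable {q σ c : ℝ} (hq0 : 0 ≤ q) (hq1 : q < 1) (hσ0 : 0 < σ) (hσ1 : σ ≤ 1) (hc : 0 < c)
  {Ω : ℕ+ → Type*} [∀ N, MeasurableSpace (Ω N)]
  {P : ∀ N, Measure (Ω N)} [∀ N, IsProbabilityMeasure (P N)] {X : ∀ N, ℕ → Ω N → ℕ}
  (hX : ∀ N : ℕ+, IsMarkovChain (P N) (X N)
      (chainInit q σ (Real.exp (-(c / √((N : ℕ) : ℝ))))) (chainTrans q σ))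

/-- The series `∑ s_n exp (-c n h) exp (-l (n h)²)`. -/
def expSeries (q σ c l h : ℝ) : ℝ :=
  ∑' n : ℕ, sSeq q σ n * Real.exp (-(c * (n * h))) * Real.exp (-(l * (n * h) ^ 2))

include hX

lemma integral_initial_eq {l : ℝ} (hl : 0 ≤ l) (N : ℕ+) :
    ∫ ω, Real.exp (-(l * (X N 0 ω * (√((N : ℕ) : ℝ))⁻¹) ^ 2)) ∂(P N) =
      1 / normConst q σ (Real.exp (-(c / √((N : ℕ) : ℝ)))) *
        expSeries q σ c l (√((N : ℕ) : ℝ))⁻¹ := by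
  rw [(hX N).integral_zero (f := fun n : ℕ => Real.exp (-(l * (n * (√((N : ℕ) : ℝ))⁻¹) ^ 2)))
    (B := 1) fun n => ?_, expSeries, ← tsum_mul_left]
  · refine tsum_congr fun n => ?_
    rw [chainInit, ← Real.exp_nat_mul]
    have : (n : ℝ) * -(c / √((N : ℕ) : ℝ)) = -(c * (n * (√((N : ℕ) : ℝ))⁻¹)) := by
      rw [div_eq_mul_inv]; ring
    rw [this]; ring
  · rw [abs_of_pos (Real.exp_pos _), Real.exp_le_one_iff, neg_nonpos]
    positivity

/-- Forced by total mass one, so the infinite product for C need not be evaluated. -/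
lemma inv_normConst_eq (N : ℕ+) : 1 / normConst q σ (Real.exp (-(c / √((N : ℕ) : ℝ)))) =
    (expSeries q σ c 0 (√((N : ℕ) : ℝ))⁻¹)⁻¹ := by
  have h := integral_initial_eq hX le_rfl N
  simp only [zero_mul, neg_zero, Real.exp_zero, integral_const, probReal_univ, one_smul] at h
  exact eq_inv_of_mul_eq_one_left h.symm

include hq0 hq1 hσ0 hσ1 hc

/-- A quotient of two Riemann sums, in which K and h^2 cancel. -/
lemma tendsto_integral_initial {l : ℝ} (hl : 0 ≤ l) :
    Tendsto (fun N => ∫ ω, Real.exp (-(l * (X N 0 ω * (√((N : ℕ) : ℝ))⁻¹) ^ 2)) ∂(P N)) atTop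
      (𝓝 (c ^ 2 *
        ∫ x in Set.Ioi (0 : ℝ), x * Real.exp (-(c * x)) * Real.exp (-(l * x ^ 2)))) := by
  obtain ⟨K, hK, ht, hb⟩ := exists_tendsto_sDiff hq0 hq1 hσ0 hσ1
  have hS := sPrev_nonneg hq0 hq1 hσ0 hσ1
  have h1 := (tendsto_riemann_sum hc hl ht hb hS).comp tendsto_inv_sqrt_pnat
  have h0 := (tendsto_riemann_sum hc le_rfl ht hb hS).comp tendsto_inv_sqrt_pnat
  simp only [zero_mul, neg_zero, Real.exp_zero, mul_one, integral_mul_exp_neg hc] at h0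
  have h2 := h1.div h0 (by positivity)
  have e : ∀ I : ℝ, K * I / (K * (1 / c ^ 2)) = c ^ 2 * I := fun I => by field_simp
  rw [e] at h2
  refine h2.congr fun N => ?_
  rw [integral_initial_eq hX hl, inv_normConst_eq hX]
  have hN : (0 : ℝ) < (N : ℕ) := by exact_mod_cast N.pos
  have hh : (√((N : ℕ) : ℝ))⁻¹ ^ 2 ≠ 0 := by positivity
  have e0 : expSeries q σ c 0 (√((N : ℕ) : ℝ))⁻¹ =
      ∑' n : ℕ, sSeq q σ n * Real.exp (-(c * (n * (√((N : ℕ) : ℝ))⁻¹))) := by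
    simp [expSeries]
  simp only [Pi.div_apply, Function.comp_apply]
  rw [e0, mul_div_mul_left _ _ hh, div_eq_inv_mul]
  rfl

/-- h^2 C tends to K/c^2, so C has order N. -/
lemma tendsto_inv_normConst :
    Tendsto (fun N : ℕ+ => 1 / normConst q σ (Real.exp (-(c / √((N : ℕ) : ℝ))))) atTop (𝓝 0) := by
  obtain ⟨K, hK, ht, hb⟩ := exists_tendsto_sDiff hq0 hq1 hσ0 hσ1
  have hS := sPrev_nonneg hq0 hq1 hσ0 hσ1
  have h0 := (tendsto_riemann_sum hc le_rfl ht hb hS).comp tendsto_inv_sqrt_pnat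
  have hI : K * ∫ x in Set.Ioi (0 : ℝ), x * Real.exp (-(c * x)) * Real.exp (-(0 * x ^ 2)) ≠ 0 := by
    simp only [zero_mul, neg_zero, Real.exp_zero, mul_one, integral_mul_exp_neg hc]
    positivity
  have h1 := ((tendsto_nhdsWithin_iff.mp tendsto_inv_sqrt_pnat).1.pow 2).div h0 hI
  rw [zero_pow two_ne_zero, zero_div] at h1
  refine h1.congr fun N => ?_
  rw [inv_normConst_eq hX]
  have hN : (0 : ℝ) < (N : ℕ) := by exact_mod_cast N.pos
  have hh : (√((N : ℕ) : ℝ))⁻¹ ^ 2 ≠ 0 := by positivity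
  simp only [Pi.div_apply, Function.comp_apply]
  rw [div_mul_cancel_left₀ hh]
  rfl

lemma chainInit_le (N : ℕ+) (n : ℕ) : chainInit q σ (Real.exp (-(c / √((N : ℕ) : ℝ)))) n ≤
    1 / normConst q σ (Real.exp (-(c / √((N : ℕ) : ℝ)))) * revWeight q σ n := by
  have hs : ∀ n, 0 ≤ sSeq q σ n := fun n => sPrev_nonneg hq0 hq1 hσ0 hσ1 (n + 1)
  have hD : 0 ≤ 1 / normConst q σ (Real.exp (-(c / √((N : ℕ) : ℝ)))) := by
    rw [inv_normConst_eq hX]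
    refine inv_nonneg.mpr (tsum_nonneg fun n => ?_)
    have := hs n
    positivity
  refine mul_le_mul_of_nonneg_left ((mul_le_of_le_one_left (hs n) ?_).trans
    (sSeq_le_revWeight hq0 hq1 hσ0 hσ1 n)) hD
  refine pow_le_one₀ (Real.exp_pos _).le (Real.exp_le_one_iff.mpr ?_)
  have : 0 ≤ c / √((N : ℕ) : ℝ) := by positivity
  linarith

/-- η is the supremum over k. First M is chosen to make `stepErr` small beyond it, then N to make
the mass below M small. -/
lemma exists_tendsto_stepErr_bound : ∃ η : ℕ+ → ℝ, Tendsto η atTop (𝓝 0) ∧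
    ∀ N k, ∫ ω, stepErr q σ (X N k ω) ∂(P N) ≤ η N := by
  have hlim := tendsto_stepErr hq0 hq1 hσ0 hσ1
  obtain ⟨B, hB⟩ := hlim.bddAbove_range
  have hB' : ∀ n, stepErr q σ n ≤ B := fun n => hB ⟨n, rfl⟩
  have h0 : ∀ n, 0 ≤ stepErr q σ n := stepErr_nonneg q σ
  have hbdd : ∀ N, BddAbove (Set.range fun k => ∫ ω, stepErr q σ (X N k ω) ∂(P N)) := by
    intro N
    refine ⟨B, ?_⟩
    rintro _ ⟨k, rfl⟩
    have := integral_mono_of_nonneg (μ := P N) (f := fun ω => stepErr q σ (X N k ω))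
      (g := fun _ => B) (ae_of_all _ fun ω => h0 _) (integrable_const B)
      (ae_of_all _ fun ω => hB' _)
    simpa using this
  refine ⟨fun N => ⨆ k, ∫ ω, stepErr q σ (X N k ω) ∂(P N), ?_, fun N k => le_ciSup (hbdd N) k⟩
  have hnn : ∀ N, 0 ≤ ⨆ k, ∫ ω, stepErr q σ (X N k ω) ∂(P N) := fun N =>
    Real.iSup_nonneg fun k => integral_nonneg fun ω => h0 _
  rw [Metric.tendsto_atTop']
  intro ε hε
  obtain ⟨M, hM⟩ := eventually_atTop.mp (hlim.eventually_le_const (show 0 < ε / 4 by positivity))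
  have hD := (tendsto_inv_normConst hq0 hq1 hσ0 hσ1 hc hX).mul_const
    (B * ∑ n ∈ range M, revWeight q σ n)
  rw [zero_mul] at hD
  obtain ⟨N₀, hN₀⟩ := eventually_atTop.mp
    (hD.eventually_le_const (show 0 < ε / 4 by positivity))
  refine ⟨N₀, fun N hN => ?_⟩
  rw [Real.dist_eq, sub_zero, abs_of_nonneg (hnn N)]
  have : ⨆ k, ∫ ω, stepErr q σ (X N k ω) ∂(P N) ≤ ε / 4 + ε / 4 := ciSup_le fun k =>
    ((hX N).integral_le_of_bound hq0 hq1 hσ0 hσ1 (chainInit_le hq0 hq1 hσ0 hσ1 hc hX N)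
      h0 hB' (by positivity) hM k).trans (by linarith [hN₀ N hN.le])
  linarith

/-- Induction on the number of times. The stretch between the last two times is replaced by the
flow, and the flow is absorbed into the peeled weights of a shorter functional. -/
lemma tendsto_integral_gaussWeight (d : ℕ) {t : Fin (d + 1) → ℝ≥0} (ht0 : t 0 = 0)
    (ht : StrictMono t) {l : Fin (d + 1) → ℝ} (hl : ∀ i, 0 ≤ l i) :
    Tendsto (fun N : ℕ+ => ∫ ω, gaussWeight l
        (fun i => (X N ⌊((N : ℕ) : ℝ) * (t i : ℝ)⌋₊ ω : ℝ) / √((N : ℕ) : ℝ)) ∂(P N)) atTop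
      (𝓝 (besselLaplace σ c d t l)) := by
  induction d with
  | zero =>
    refine (tendsto_integral_initial hq0 hq1 hσ0 hσ1 hc hX (hl 0)).congr fun N => ?_
    refine integral_congr_ae (ae_of_all _ fun ω => ?_)
    simp [gaussWeight, ht0, div_eq_mul_inv]
  | succ d ih =>
    obtain ⟨η, hη, hη'⟩ := exists_tendsto_stepErr_bound hq0 hq1 hσ0 hσ1 hc hX
    obtain ⟨B, hB⟩ := (tendsto_stepErr hq0 hq1 hσ0 hσ1).bddAbove_range
    have hB' : ∀ n, stepErr q σ n ≤ B := fun n => hB ⟨n, rfl⟩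
    have hpeel := ih (t := fun i => t i.castSucc) (by simpa using ht0) (strictMono_castSucc ht)
      (peelWeight_nonneg hσ0 ht hl)
    have hτ0 := sub_div_nonneg_of_strictMono hσ0 ht
    set T : ℝ≥0 := t (Fin.last (d + 1)) with hT
    set S : ℝ≥0 := t (Fin.last d).castSucc with hS
    have hST : S ≤ T := ht.monotone (Fin.le_last _)
    set L := l (Fin.last (d + 1)) with hL
    have hL0 : 0 ≤ L := hl _
    set τ := ((T : ℝ) - S) / (1 + σ) with hτ
    set m : ℕ+ → ℕ := fun N => ⌊((N : ℕ) : ℝ) * (S : ℝ)⌋₊ with hm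
    set k : ℕ+ → ℕ := fun N => ⌊((N : ℕ) : ℝ) * (T : ℝ)⌋₊ - m N with hk
    have hmono : ∀ (N : ℕ+) {a b : ℝ≥0}, a ≤ b →
        ⌊((N : ℕ) : ℝ) * (a : ℝ)⌋₊ ≤ ⌊((N : ℕ) : ℝ) * (b : ℝ)⌋₊ := fun N a b hab => by
      have : (a : ℝ) ≤ b := by exact_mod_cast hab
      exact Nat.floor_mono (by gcongr)
    have hmk : ∀ N, m N + k N = ⌊((N : ℕ) : ℝ) * (T : ℝ)⌋₊ := fun N =>
      Nat.add_sub_cancel' (hmono N hST)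
    have hfl : ∀ a : ℝ≥0, Tendsto (fun N : ℕ+ => (⌊((N : ℕ) : ℝ) * (a : ℝ)⌋₊ : ℝ) / (N : ℕ)) atTop
        (𝓝 a) := by
      intro a
      have := (tendsto_nat_floor_mul_div_atTop a.coe_nonneg).comp tendsto_pnat_cast
      refine this.congr fun N => ?_
      simp only [Function.comp_apply, mul_comm]
    have hkN : Tendsto (fun N : ℕ+ => (k N : ℝ) / (N : ℕ)) atTop (𝓝 (T - S)) := by
      refine ((hfl T).sub (hfl S)).congr fun N => ?_
      rw [← hmk N]
      push_cast
      ring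
    set h : ℕ+ → ℝ := fun N => (√((N : ℕ) : ℝ))⁻¹ with hh
    have hN : ∀ N : ℕ+, (1 : ℝ) ≤ (N : ℕ) := fun N => by exact_mod_cast N.pos
    have hh0 : ∀ N, 0 ≤ h N := fun N => by positivity
    have hh1 : ∀ N, h N ≤ 1 := fun N => inv_le_one_of_one_le₀ (Real.one_le_sqrt.mpr (hN N))
    have hh2 : ∀ N, h N ^ 2 = (((N : ℕ) : ℝ))⁻¹ := fun N => by
      rw [hh, inv_pow, Real.sq_sqrt (Nat.cast_nonneg _)]
    have hht : Tendsto h atTop (𝓝 0) := (tendsto_nhdsWithin_iff.mp tendsto_inv_sqrt_pnat).1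
    set Z : ∀ N : ℕ+, Ω N → ℝ := fun N ω => gaussWeight (fun i : Fin (d + 1) => l i.castSucc)
      fun i => (X N ⌊((N : ℕ) : ℝ) * (t i.castSucc : ℝ)⌋₊ ω : ℝ) / √((N : ℕ) : ℝ) with hZ
    have hZdep : ∀ N, DependsUpTo (X N) (m N) (Z N) := by
      intro N ω ω' hω
      simp only [hZ]
      congr 1
      funext i
      rw [hω _ (hmono N ((strictMono_castSucc ht).monotone (Fin.le_last i)))]
    have hZ0 : ∀ N ω, 0 ≤ Z N ω := fun N ω => (gaussWeight_pos _ _).le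
    have hZ1 : ∀ N ω, Z N ω ≤ 1 := fun N ω => gaussWeight_le_one (fun i => hl _) _
    have hfull : ∀ N, ∫ ω, gaussWeight l
        (fun i => (X N ⌊((N : ℕ) : ℝ) * (t i : ℝ)⌋₊ ω : ℝ) / √((N : ℕ) : ℝ)) ∂(P N) =
        ∫ ω, Z N ω * gaussFlow L 0 (X N (m N + k N) ω * h N) ∂(P N) := by
      intro N
      refine integral_congr_ae (ae_of_all _ fun ω => ?_)
      simp only
      rw [gaussWeight_succ, gaussFlow_zero, hmk N]
      rfl
    have hlast : ∀ N, ∫ ω, Z N ω * gaussFlow L τ (X N (m N) ω * h N) ∂(P N) =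
        gaussScale L τ * ∫ ω, gaussWeight (peelWeight σ t l) (fun i =>
          (X N ⌊((N : ℕ) : ℝ) * (t i.castSucc : ℝ)⌋₊ ω : ℝ) / √((N : ℕ) : ℝ)) ∂(P N) := by
      intro N
      rw [← integral_const_mul]
      refine integral_congr_ae (ae_of_all _ fun ω => ?_)
      exact gaussWeight_mul_gaussFlow σ t l fun i =>
          (X N ⌊((N : ℕ) : ℝ) * (t i.castSucc : ℝ)⌋₊ ω : ℝ) / √((N : ℕ) : ℝ)
    -- Since h^2 = 1/N, the k steps contribute k/N, which stays bounded, times η + h, which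
    -- vanishes.
    have hb1 : ∀ N, |∫ ω, Z N ω * gaussFlow L 0 (X N (m N + k N) ω * h N) ∂(P N)
        - ∫ ω, Z N ω * gaussFlow L (k N * (h N ^ 2 / (1 + σ))) (X N (m N) ω * h N) ∂(P N)| ≤
        (k N : ℝ) / (N : ℕ) * (stepConst L * (η N + h N)) := by
      intro N
      have := (hX N).abs_integral_sub_le hq0 hq1 hσ0 hσ1 hL0 (hh0 N) (hh1 N) (hη' N) hB'
        (hZdep N) (hZ0 N) (hZ1 N) (k N) (le_refl (0 : ℝ))
      rw [zero_add] at this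
      refine this.trans (le_of_eq ?_)
      rw [hh2]; ring
    have hτN : ∀ N, 0 ≤ (k N : ℝ) * (h N ^ 2 / (1 + σ)) := fun N => by positivity
    -- Corrects the rounding of times by floors: the flow is Lipschitz in time with constant 5L.
    have hb2 : ∀ N, |∫ ω, Z N ω * gaussFlow L (k N * (h N ^ 2 / (1 + σ))) (X N (m N) ω * h N) ∂(P N)
        - ∫ ω, Z N ω * gaussFlow L τ (X N (m N) ω * h N) ∂(P N)| ≤
        5 * L * |k N * (h N ^ 2 / (1 + σ)) - τ| := by
      intro N
      have hZm := (hX N).measurable_of_dependsUpTo (hZdep N)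
      have hint : ∀ s : ℝ, 0 ≤ s →
          Integrable (fun ω => Z N ω * gaussFlow L s (X N (m N) ω * h N)) (P N) := by
        intro s hs
        refine Integrable.of_bound (C := 1) (hZm.mul ((measurable_of_countable
          fun n : ℕ => gaussFlow L s (n * h N)).comp ((hX N).measurable _))).aestronglyMeasurable
          (ae_of_all _ fun ω => ?_)
        rw [Real.norm_of_nonneg (mul_nonneg (hZ0 N ω) (gaussFlow_pos hL0 hs _).le)]
        exact mul_le_one₀ (hZ1 N ω) (gaussFlow_pos hL0 hs _).le (gaussFlow_le_one hL0 hs _)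
      rw [← integral_sub (hint _ (hτN N)) (hint _ hτ0)]
      have := norm_integral_le_of_norm_le_const (μ := P N) (f := fun ω =>
        Z N ω * gaussFlow L (k N * (h N ^ 2 / (1 + σ))) (X N (m N) ω * h N) -
          Z N ω * gaussFlow L τ (X N (m N) ω * h N))
        (C := 5 * L * |k N * (h N ^ 2 / (1 + σ)) - τ|) (ae_of_all _ fun ω => by
          rw [← mul_sub, Real.norm_eq_abs, abs_mul, abs_of_nonneg (hZ0 N ω)]
          exact (mul_le_of_le_one_left (abs_nonneg _) (hZ1 N ω)).trans
            (abs_gaussFlow_sub_le hL0 (hτN N) hτ0 _))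
      simpa using this
    have hτlim : Tendsto (fun N => (k N : ℝ) * (h N ^ 2 / (1 + σ))) atTop (𝓝 τ) := by
      refine (hkN.div_const (1 + σ)).congr fun N => ?_
      rw [hh2]; ring
    have hz1 : Tendsto (fun N => (k N : ℝ) / (N : ℕ) * (stepConst L * (η N + h N))) atTop (𝓝 0) := by
      have := hkN.mul ((hη.add hht).const_mul (stepConst L))
      simpa using this
    have hz2 : Tendsto (fun N => 5 * L * |k N * (h N ^ 2 / (1 + σ)) - τ|) atTop (𝓝 0) := by
      have := ((hτlim.sub_const τ).abs).const_mul (5 * L)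
      simpa using this
    have hdiff : Tendsto (fun N => ∫ ω, Z N ω * gaussFlow L 0 (X N (m N + k N) ω * h N) ∂(P N)
        - ∫ ω, Z N ω * gaussFlow L τ (X N (m N) ω * h N) ∂(P N)) atTop (𝓝 0) := by
      refine squeeze_zero_norm (fun N => ?_) (by simpa using hz1.add hz2)
      exact (abs_sub_le _ _ _).trans (add_le_add (hb1 N) (hb2 N))
    have hfin := hdiff.add (hpeel.const_mul (gaussScale L τ))
    rw [zero_add] at hfin
    refine hfin.congr fun N => ?_
    rw [hfull N, ← hlast N, sub_add_cancel]

/-- The limit enters only through its Laplace functional, so the explicit joint law and the Markov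
process are treated alike. -/
lemma tendstoInDistribution_of_integral_gaussWeight {d : ℕ} {t : Fin (d + 1) → ℝ≥0}
    (ht0 : t 0 = 0) (ht : StrictMono t) {Ω' : Type*} [MeasurableSpace Ω'] {P' : Measure Ω'}
    [IsProbabilityMeasure P'] {W : Ω' → Fin (d + 1) → ℝ} (hW : Measurable W)
    (hW0 : ∀ᵐ ω ∂P', ∀ i, 0 < W ω i)
    (hlap : ∀ l : Fin (d + 1) → ℝ, (∀ i, 0 ≤ l i) →
      ∫⁻ ω, ENNReal.ofReal (gaussWeight l (W ω)) ∂P' =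
        ENNReal.ofReal (besselLaplace σ c d t l)) :
    TendstoInDistribution
      (fun (N : ℕ+) (ω : Ω N) (i : Fin (d + 1)) =>
        (X N ⌊((N : ℕ) : ℝ) * (t i : ℝ)⌋₊ ω : ℝ) / √((N : ℕ) : ℝ))
      atTop W P P' := by
  refine tendstoInDistribution_of_tendsto_gaussWeight (fun N => ?_) hW (fun N ω i => by positivity)
    (hW0.mono fun ω hω i => (hω i).le) fun l hl => ?_
  · exact measurable_pi_lambda _ fun i =>
      ((measurable_of_countable (fun n : ℕ => (n : ℝ))).comp ((hX N).measurable _)).div_const _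
  · have e : ∫ ω, gaussWeight l (W ω) ∂P' = besselLaplace σ c d t l := by
      rw [integral_eq_lintegral_of_nonneg_ae (ae_of_all _ fun ω => (gaussWeight_pos _ _).le)
        ((measurable_gaussWeight l).comp hW).aestronglyMeasurable, hlap l hl,
        ENNReal.toReal_ofReal (besselLaplace_nonneg hσ0 d ht hl)]
    rw [e]
    exact tendsto_integral_gaussWeight hq0 hq1 hσ0 hσ1 hc hX d ht0 ht hl

end

end

/-! ### The limit theorem, for the explicit joint law and for the Markov process. -/

theorem theorem2 (q σ c : ℝ) (hq0 : 0 ≤ q) (hq1 : q < 1) (hσ0 : 0 < σ) (hσ1 : σ ≤ 1) (hc : 0 < c)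
    {Ω : ℕ+ → Type*} [∀ N, MeasurableSpace (Ω N)]
    (P : ∀ N, Measure (Ω N)) [∀ N, IsProbabilityMeasure (P N)]
    (X : ∀ N, ℕ → Ω N → ℕ)
    (hX : ∀ N : ℕ+, IsMarkovChain (P N) (X N)
      (chainInit q σ (Real.exp (-(c / √((N : ℕ) : ℝ))))) (chainTrans q σ)) :
    (∀ (d : ℕ) (t : Fin (d + 1) → ℝ≥0), t 0 = 0 → StrictMono t →
      ∃ _ : IsProbabilityMeasure (besselJointLaw σ c t),
        TendstoInDistribution
          (fun (N : ℕ+) (ω : Ω N) (i : Fin (d + 1)) =>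
            (X N ⌊((N : ℕ) : ℝ) * (t i : ℝ)⌋₊ ω : ℝ) / √((N : ℕ) : ℝ))
          atTop (fun x : Fin (d + 1) → ℝ => x) P (besselJointLaw σ c t)) ∧
    (∀ {Ω' : Type*} [MeasurableSpace Ω'] (P' : Measure Ω') [IsProbabilityMeasure P']
      (ξ : ℝ≥0 → Ω' → ℝ), IsMarkovProcess P' ξ (besselInit c) (besselTrans σ) →
      ∀ (d : ℕ) (t : Fin d → ℝ≥0),
        TendstoInDistribution
          (fun (N : ℕ+) (ω : Ω N) (i : Fin d) =>
            (X N ⌊((N : ℕ) : ℝ) * (t i : ℝ)⌋₊ ω : ℝ) / √((N : ℕ) : ℝ))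
          atTop (fun (ω : Ω') (i : Fin d) => ξ (t i) ω) P P') := by
  refine ⟨fun d t ht0 ht => ?_, fun {Ω'} _ P' _ ξ hξ d t => ?_⟩
  · have hprob := isProbabilityMeasure_besselJointLaw hσ0 hc ht
    exact ⟨hprob, tendstoInDistribution_of_integral_gaussWeight hq0 hq1 hσ0 hσ1 hc hX ht0 ht
      measurable_id (ae_besselJointLaw_pos σ c t)
      fun l hl => lintegral_besselJointLaw hσ0 hc d ht hl⟩
  -- Here the times may be unordered, repeated or omit 0. They are completed by 0 and sorted into u;
  -- the coordinate map r then recovers the original vector by continuous mapping.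
  · set T : Finset ℝ≥0 := insert 0 (univ.image t) with hT
    have hpos : 0 < T.card := Finset.card_pos.mpr ⟨0, Finset.mem_insert_self _ _⟩
    obtain ⟨m, hm⟩ : ∃ m, T.card = m + 1 := ⟨T.card - 1, by omega⟩
    set u := T.orderEmbOfFin hm with hu
    have hu0 : u 0 = 0 := by
      have h := T.orderEmbOfFin_zero hm (Nat.succ_pos m)
      exact h.trans (le_antisymm (T.min'_le _ (Finset.mem_insert_self _ _)) zero_le)
    have hex : ∀ i, ∃ j, u j = t i := fun i => by
      have h : t i ∈ Set.range u := by
        rw [hu, Finset.range_orderEmbOfFin]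
        exact Finset.mem_coe.mpr (Finset.mem_insert_of_mem
          (Finset.mem_image_of_mem t (Finset.mem_univ i)))
      exact h
    choose r hr using hex
    have hpos' : ∀ᵐ ω ∂P', ∀ i, 0 < ξ (u i) ω := ae_all_iff.mpr fun i => hξ.ae_pos (u i)
    have hconv := tendstoInDistribution_of_integral_gaussWeight hq0 hq1 hσ0 hσ1 hc hX (t := u)
      hu0 u.strictMono (W := fun ω i => ξ (u i) ω)
      (measurable_pi_lambda _ fun i => hξ.measurable (u i)) hpos'
      fun l hl => hξ.lintegral_gaussWeight hσ0 hc m hu0 u.strictMono hl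
    have hg : Continuous fun (x : Fin (m + 1) → ℝ) (i : Fin d) => x (r i) := by fun_prop
    have h := hconv.continuous_comp hg
    simp only [Function.comp_def, hr] at h
    exact h
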